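/- **Conventions.** C*-algebras are complex, not necessarily unital, and possibly zero; $*$-homomorphisms need not be unital. Write $I=[0,1]$; for a C*-algebra $F$ and $k\ge 1$ put $\mathbf I^kF=C(I^k,F)$ and $\mathbf S^{k-1}F=C(\partial I^k,F)$, where $\partial I^k\cong S^{k-1}$ is the boundary of the cube. An *$n$-dimensional NCCW complex* is a sequence $A_0,A_1,\dots,A_n$ of C*-algebras such that $A_0$ is of finite linear dimension and, for each $1\le k\le n$, there are a C*-algebra $F_k$ of finite linear dimension and a $*$-homomorphism $\sigma_k:A_{k-1}\to\mathbf S^{k-1}F_k$ for which $A_k$ is the pullback $$A_k=\mathbf I^kF_k\oplus_{\mathbf S^{k-1}F_k}A_{k-1}=\{(g,a): g|_{\partial I^k}=\sigma_k(a)\},$$ with the projection $\pi_k:A_k\to A_{k-1}$, $(g,a)\mapsto a$. For $k>n$ put $A_k=A_n$, and for all $k\ge 0$ let $p_k^A:A_n\to A_k$ be the composite of these projections (the identity for $k\ge n$). Let $\{A_0,\dots,A_n\}$ and $\{B_0,\dots,B_m\}$ be NCCW complexes, $A=A_n$, $B=B_m$. A $*$-homomorphism $h:A\to B$ is a *cellular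 NCCW complex map* if for every $k\ge 0$ there is a $*$-homomorphism $h_k:A_k\to B_k$ with $p_k^B\circ h=h_k\circ p_k^A$. Two $*$-homomorphisms $f,h:A\to B$ are *homotopic* if there is a $*$-homomorphism $\Phi:A\to C(I)\otimes B\cong C(I,B)$ with $\mathrm{ev}_0\circ\Phi=f$ and $\mathrm{ev}_1\circ\Phi=h$. **Theorem.** Let $\{A_0,\dots,A_n\}$ and $\{B_0,\dots,B_m\}$ be two NCCW complexes and $f:A=A_n\to B_m=B$ a $*$-homomorphism. Then $f$ is homotopic to a cellular NCCW complex map $h:A\to B$. -/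

import Mathlib

open scoped unitInterval

universe u v

/-- The structure of an `n`-dimensional noncommutative CW complex: a sequence `A_0, …, A_n` of
C*-algebras in which `A_0` has finite linear dimension and each `A_{k+1}` is presented as the
pullback `I^{k+1}F ⊕_{S^k F} A_k`, where `F = F_{k+1}` is a C*-algebra of finite linear dimension,
`I^{k+1}F = C([0,1]^{k+1}, F)`, and `S^k F = C(∂[0,1]^{k+1}, F)`.  C*-algebras need not be unital
and may be zero. -/
structure NCCWComplex (n : ℕ) where
  /-- The C*-algebras `A_0, …, A_n`. -/
  algebra : Fin (n + 1) → Type u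
  [cstar : ∀ k, NonUnitalCStarAlgebra (algebra k)]
  /-- `A_0` has finite linear dimension. -/
  finiteDimensional_zero : FiniteDimensional ℂ (algebra 0)
  /-- `coeff k` is the algebra `F_{k+1}` of coefficients of the cells of dimension `k + 1`. -/
  coeff : Fin n → Type u
  [coeffCStar : ∀ k, NonUnitalCStarAlgebra (coeff k)]
  finiteDimensional_coeff : ∀ k, FiniteDimensional ℂ (coeff k)
  /-- The projection `π : A_{k+1} → A_k`. -/
  toPrev : ∀ k : Fin n, algebra k.succ →⋆ₙₐ[ℂ] algebra k.castSucc
  /-- The projection `ρ : A_{k+1} → I^{k+1} F_{k+1}`. -/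
  toCube : ∀ k : Fin n, algebra k.succ →⋆ₙₐ[ℂ] C(Fin ((k : ℕ) + 1) → I, coeff k)
  /-- The connecting morphism `σ : A_k → S^k F_{k+1}`. -/
  attach : ∀ k : Fin n,
    algebra k.castSucc →⋆ₙₐ[ℂ] C(Cube.boundary (Fin ((k : ℕ) + 1)), coeff k)
  /-- The square commutes: the restriction of `ρ x` to the boundary of the cube is `σ (π x)`. -/
  comm : ∀ (k : Fin n) (x : algebra k.succ),
    (toCube k x).restrict (Cube.boundary (Fin ((k : ℕ) + 1))) = attach k (toPrev k x)
  /-- The square is a pullback: `x ↦ (ρ x, π x)` identifies `A_{k+1}` with the algebra of all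
  compatible pairs. -/
  pullback : ∀ (k : Fin n) (g : C(Fin ((k : ℕ) + 1) → I, coeff k)) (a : algebra k.castSucc),
    g.restrict (Cube.boundary (Fin ((k : ℕ) + 1))) = attach k a →
      ∃! x : algebra k.succ, toCube k x = g ∧ toPrev k x = a

namespace NCCWComplex

attribute [instance] NCCWComplex.cstar NCCWComplex.coeffCStar

/-- The C*-algebra `A = A_n` of the complex. -/
abbrev top {n : ℕ} (A : NCCWComplex.{u} n) : Type u := A.algebra (Fin.last n)

/-- The composite projection `A = A_n → A_{n-1} → ⋯ → A_k`. -/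
def proj {n : ℕ} (A : NCCWComplex.{u} n) (k : Fin (n + 1)) : A.top →⋆ₙₐ[ℂ] A.algebra k :=
  Fin.reverseInduction (motive := fun k => A.top →⋆ₙₐ[ℂ] A.algebra k)
    (NonUnitalStarAlgHom.id ℂ A.top) (fun j p => (A.toPrev j).comp p) k

/-- The `k`-skeleton for an arbitrary `k : ℕ`: it is `A_k` for `k ≤ n`, and `A_n` for `k ≥ n`. -/
abbrev skeleton {n : ℕ} (A : NCCWComplex.{u} n) (k : ℕ) : Type u :=
  A.algebra ⟨min k n, by omega⟩

/-- The projection of `A` onto its `k`-skeleton. -/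
def toSkeleton {n : ℕ} (A : NCCWComplex.{u} n) (k : ℕ) : A.top →⋆ₙₐ[ℂ] A.skeleton k :=
  A.proj ⟨min k n, by omega⟩

/-- A *-homomorphism `h : A → B` between NCCW complexes is cellular if for every `k` it descends
to a *-homomorphism `A_k → B_k` of the `k`-skeletons. -/
def IsCellular {n m : ℕ} (A : NCCWComplex.{u} n) (B : NCCWComplex.{v} m)
    (h : A.top →⋆ₙₐ[ℂ] B.top) : Prop :=
  ∀ k : ℕ, ∃ hk : A.skeleton k →⋆ₙₐ[ℂ] B.skeleton k,
    ∀ a : A.top, B.toSkeleton k (h a) = hk (A.toSkeleton k a)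

end NCCWComplex

/-- Two *-homomorphisms `φ, ψ : A → B` of C*-algebras are homotopic if there is a *-homomorphism
`Φ : A → C(I) ⊗ B = C(I, B)` with `Φ(0, ·) = φ` and `Φ(1, ·) = ψ`. -/
def CStarHomotopic {A : Type u} {B : Type v} [NonUnitalCStarAlgebra A] [NonUnitalCStarAlgebra B]
    (φ ψ : A →⋆ₙₐ[ℂ] B) : Prop :=
  ∃ Φ : A →⋆ₙₐ[ℂ] C(I, B), (∀ a, Φ a 0 = φ a) ∧ (∀ a, Φ a 1 = ψ a)

/-!
The proof is a cellular approximation argument in which the points of a space are replaced by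
*-homomorphisms into a C*-algebra `G` of finite linear dimension, with the topology of pointwise
norm convergence. A *-homomorphism `A_k → G` can be pictured as a finite configuration of points in
the cells, labelled by representations, and deformations of the cells act on *-homomorphisms by
moving their supports (`exists_push`). The claim to prove is that `Hom(A_k, G)` is
`Hom(A_{k+1}, G)` up to homotopy in dimensions up to `k`: a family of *-homomorphisms over a cube
of dimension at most `k` can be deformed, keeping its boundary inside
`Hom(A_k, G)`, into `Hom(A_k, G)` (`compressible_factoringThrough_castSucc`).

This is proved for a single cell by induction on its dimension `d` (`cellsCompressible`), for
families over cubes of dimension less than `d`. Take `dim G + 1` disjoint spherical shells around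
the centre of the cell. Bump functions on the shells have orthogonal images in `G`, so one of them
has image of norm less than `1`, and then the support misses the part of the shell where the bump
is `1` (`mem_supportedOn_diff`). That the norm is less than `1` is an open condition, so a fine grid
on the parameter cube has for each of its cells one shell which the supports over that cell all
miss (`exists_grid_refinement`). Over a grid cell the ball inside the shell is isolated from the
rest of the support, and can be moved off the centre independently
(`compressible_isolated_ball`): over the boundary of the parameter cube, where the support already
misses the centre, it is stretched to the boundary of the ball and then moved off the top face of
the ball, which is a cell of lower dimension; after that the whole ball is pushed down onto its
bottom face. As compressions are relative to the boundary, those on the grid cells can be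
found one skeleton after the other so that they fit together (`exists_homotopy_of_gridCell`). Once
all supports miss the centre of the cell, they are pushed radially to its boundary.

A homotopy of `f : A → B` is then built on `B_0, B_1, …` in turn (`exists_path_proj`). A path of
*-homomorphisms `A → B_k` whose end factors as it should extends to `B_{k+1}`: by the pullback
property this means to extend to the cube `I^{k+1}` a homotopy of families of *-homomorphisms into
`F_{k+1}` that is given at the start and on the boundary, and it has to end in those which factor
through `A_{k+1}` (`exists_path_succ`). This is what compressibility provides.
-/

namespace CellularApprox

open Set Topology Metric

/-! ### Compression of maps of cubes -/

section Compression

variable {X : Type*} [TopologicalSpace X] {ι : Type*} [Fintype ι]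

/-- The maps `f` and `g` of the cube `[-1, 1]^ι` (the closed unit ball of the sup norm) into `W`
are homotopic in `W` through maps which send the boundary of the cube to `T`. -/
def PairHomotopic (W T : Set X) (f g : (ι → ℝ) → X) : Prop :=
  ∃ H : ℝ × (ι → ℝ) → X, ContinuousOn H (Icc 0 1 ×ˢ closedBall 0 1) ∧
    (∀ x ∈ closedBall (0 : ι → ℝ) 1, H (0, x) = f x) ∧
    (∀ x ∈ closedBall (0 : ι → ℝ) 1, H (1, x) = g x) ∧
    MapsTo H (Icc 0 1 ×ˢ closedBall 0 1) W ∧ MapsTo H (Icc 0 1 ×ˢ sphere 0 1) T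

variable (ι) in
/-- Every map of the cube `[-1, 1]^ι` into `W` which sends the boundary to `T` can be deformed,
through such maps, into `T`. -/
def Compressible (W T : Set X) : Prop :=
  ∀ f : (ι → ℝ) → X, ContinuousOn f (closedBall 0 1) → MapsTo f (closedBall 0 1) W →
    MapsTo f (sphere 0 1) T → ∃ g, PairHomotopic W T f g ∧ MapsTo g (closedBall 0 1) T

variable (ι) in
/-- Every homotopy in `W` on the boundary of the cube `[-1, 1]^ι` which ends in `T`, together
with an extension to the cube of the map where it starts, extends to a homotopy in `W` on the
cube which ends in `T`. -/
def Fillable (W T : Set X) : Prop :=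
  ∀ h : ℝ × (ι → ℝ) → X,
    ContinuousOn h ({0} ×ˢ closedBall 0 1 ∪ Icc 0 1 ×ˢ sphere 0 1) →
    MapsTo h ({0} ×ˢ closedBall 0 1 ∪ Icc 0 1 ×ˢ sphere 0 1) W →
    (∀ x ∈ sphere (0 : ι → ℝ) 1, h (1, x) ∈ T) →
    ∃ H : ℝ × (ι → ℝ) → X, ContinuousOn H (Icc 0 1 ×ˢ closedBall 0 1) ∧
      EqOn H h ({0} ×ˢ closedBall 0 1 ∪ Icc 0 1 ×ˢ sphere 0 1) ∧
      MapsTo H (Icc 0 1 ×ˢ closedBall 0 1) W ∧ ∀ x ∈ closedBall (0 : ι → ℝ) 1, H (1, x) ∈ T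

theorem PairHomotopic.trans {W T : Set X} {f g k : (ι → ℝ) → X}
    (h₁ : PairHomotopic W T f g) (h₂ : PairHomotopic W T g k) : PairHomotopic W T f k := by
  obtain ⟨H, hc, h0, h1, hW, hT⟩ := h₁
  obtain ⟨K, kc, k0, k1, kW, kT⟩ := h₂
  have key : ∀ t ∈ Icc (0 : ℝ) 1, (t ≤ 1 / 2 ∧ 2 * t ∈ Icc (0 : ℝ) 1) ∨
      (¬ t ≤ 1 / 2 ∧ 2 * t - 1 ∈ Icc (0 : ℝ) 1) := by
    intro t ht
    by_cases h : t ≤ 1 / 2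
    · exact .inl ⟨h, by constructor <;> linarith [ht.1]⟩
    · exact .inr ⟨h, by constructor <;> linarith [ht.2]⟩
  refine ⟨fun p => if p.1 ≤ 1 / 2 then H (2 * p.1, p.2) else K (2 * p.1 - 1, p.2),
    ?_, ?_, ?_, ?_, ?_⟩
  · have e : (Icc (0 : ℝ) 1 ×ˢ closedBall (0 : ι → ℝ) 1) =
        Icc (0 : ℝ) (1 / 2) ×ˢ closedBall (0 : ι → ℝ) 1 ∪
        Icc (1 / 2 : ℝ) 1 ×ˢ closedBall (0 : ι → ℝ) 1 := by
      rw [← union_prod, Icc_union_Icc_eq_Icc] <;> norm_num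
    rw [e]
    refine ContinuousOn.union_of_isClosed ?_ ?_ (isClosed_Icc.prod isClosed_closedBall)
      (isClosed_Icc.prod isClosed_closedBall)
    · have : ContinuousOn (fun p : ℝ × (ι → ℝ) => H (2 * p.1, p.2))
          (Icc (0 : ℝ) (1 / 2) ×ˢ closedBall (0 : ι → ℝ) 1) := by
        refine hc.comp (by fun_prop) ?_
        rintro ⟨t, x⟩ ⟨ht, hx⟩
        exact ⟨⟨by linarith [ht.1], by linarith [ht.2]⟩, hx⟩
      refine this.congr ?_
      rintro ⟨t, x⟩ ⟨ht, hx⟩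
      exact if_pos ht.2
    · have : ContinuousOn (fun p : ℝ × (ι → ℝ) => K (2 * p.1 - 1, p.2))
          (Icc (1 / 2 : ℝ) 1 ×ˢ closedBall (0 : ι → ℝ) 1) := by
        refine kc.comp (by fun_prop) ?_
        rintro ⟨t, x⟩ ⟨ht, hx⟩
        exact ⟨⟨by linarith [ht.1], by linarith [ht.2]⟩, hx⟩
      refine this.congr ?_
      rintro ⟨t, x⟩ ⟨ht, hx⟩
      dsimp only
      split_ifs with h
      · have : t = 1 / 2 := le_antisymm h ht.1
        subst this
        norm_num
        rw [h1 x hx, k0 x hx]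
      · rfl
  · intro x hx
    simp [h0 x hx]
  · intro x hx
    norm_num
    exact k1 x hx
  · rintro ⟨t, x⟩ ⟨ht, hx⟩
    rcases key t ht with ⟨h, h'⟩ | ⟨h, h'⟩
    · simpa [h, -one_div] using hW (mk_mem_prod h' hx)
    · simpa [h, -one_div] using kW (mk_mem_prod h' hx)
  · rintro ⟨t, x⟩ ⟨ht, hx⟩
    rcases key t ht with ⟨h, h'⟩ | ⟨h, h'⟩
    · simpa [h, -one_div] using hT (mk_mem_prod h' hx)
    · simpa [h, -one_div] using kT (mk_mem_prod h' hx)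

theorem Compressible.refl (W : Set X) : Compressible ι W W := fun f hf hW _ =>
  ⟨f, ⟨fun p => f p.2, hf.comp continuousOn_snd fun _ hp => hp.2, fun _ _ => rfl, fun _ _ => rfl,
    fun _ hp => hW hp.2, fun _ hp => hW (sphere_subset_closedBall hp.2)⟩, hW⟩

/-- The data of an extension problem `{0} × cube ∪ [0, 1] × boundary → W` form a map of a bigger
cube, to which the compression applies. -/
theorem Compressible.fillable {W T : Set X} (hc : Compressible ι W T) :
    Fillable ι W T := by
  intro h hcont hW hT
  have nn : ∀ x : ι → ℝ, 1 / 2 ≤ ‖x‖ → ‖(‖x‖⁻¹ • x)‖ = 1 := by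
    intro x hx
    rw [norm_smul, norm_inv, norm_norm, inv_mul_cancel₀ (by linarith)]
  set f : (ι → ℝ) → X := fun x =>
    if ‖x‖ ≤ 1 / 2 then h (0, (2 : ℝ) • x) else h (2 * ‖x‖ - 1, ‖x‖⁻¹ • x) with hf
  -- The part of the big cube of norm at least `1 / 2` is `[0, 1] × boundary` in polar coordinates.
  have f_out : ∀ x : ι → ℝ, 1 / 2 ≤ ‖x‖ → f x = h (2 * ‖x‖ - 1, ‖x‖⁻¹ • x) := by
    intro x hx
    by_cases h' : ‖x‖ ≤ 1 / 2
    · have : ‖x‖ = 1 / 2 := le_antisymm h' hx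
      simp only [hf, this, le_refl, if_true]
      norm_num
    · simp only [hf, h', if_false]
  have m_in : ∀ x : ι → ℝ, ‖x‖ ≤ 1 / 2 →
      ((0 : ℝ), (2 : ℝ) • x) ∈
        (({0} ×ˢ closedBall 0 1 ∪ Icc 0 1 ×ˢ sphere 0 1 : Set (ℝ × (ι → ℝ)))) := by
    intro x hx
    refine .inl ⟨rfl, ?_⟩
    simp only [mem_closedBall, dist_zero_right, norm_smul, Real.norm_ofNat]
    linarith
  have m_out : ∀ x : ι → ℝ, 1 / 2 ≤ ‖x‖ → ‖x‖ ≤ 1 →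
      (2 * ‖x‖ - 1, ‖x‖⁻¹ • x) ∈
        (({0} ×ˢ closedBall 0 1 ∪ Icc 0 1 ×ˢ sphere 0 1 : Set (ℝ × (ι → ℝ)))) := by
    intro x hx hx'
    refine .inr ⟨⟨by dsimp only; linarith, by dsimp only; linarith⟩, ?_⟩
    simpa using nn x hx
  have fcont : ContinuousOn f (closedBall 0 1) := by
    have e : closedBall (0 : ι → ℝ) 1 = {x | ‖x‖ ≤ 1 / 2} ∪ {x | 1 / 2 ≤ ‖x‖ ∧ ‖x‖ ≤ 1} := by
      ext x
      simp only [mem_closedBall, dist_zero_right, mem_union, mem_ofPred_eq]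
      constructor
      · intro hx
        rcases le_total ‖x‖ (1 / 2) with h | h
        · exact .inl h
        · exact .inr ⟨h, hx⟩
      · rintro (h | h)
        · linarith
        · exact h.2
    rw [e]
    refine ContinuousOn.union_of_isClosed ?_ ?_ (isClosed_le continuous_norm continuous_const)
      ((isClosed_le continuous_const continuous_norm).inter
        (isClosed_le continuous_norm continuous_const))
    · have : ContinuousOn (fun x : ι → ℝ => h (0, (2 : ℝ) • x)) {x | ‖x‖ ≤ 1 / 2} :=
        hcont.comp (by fun_prop) fun x hx => m_in x hx
      exact this.congr fun x hx => if_pos hx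
    · have : ContinuousOn (fun x : ι → ℝ => h (2 * ‖x‖ - 1, ‖x‖⁻¹ • x))
          {x | 1 / 2 ≤ ‖x‖ ∧ ‖x‖ ≤ 1} := by
        refine hcont.comp ?_ fun x hx => m_out x hx.1 hx.2
        refine ContinuousOn.prodMk (by fun_prop) (ContinuousOn.fun_smul ?_ continuousOn_id)
        exact continuous_norm.continuousOn.inv₀ fun x hx => by
          have := hx.1
          intro h0
          simp only [h0] at this
          norm_num at this
      exact this.congr fun x hx => f_out x hx.1
  have fW : MapsTo f (closedBall 0 1) W := by
    intro x hx
    rw [mem_closedBall, dist_zero_right] at hx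
    rcases le_total ‖x‖ (1 / 2) with h' | h'
    · have : f x = h (0, (2 : ℝ) • x) := if_pos h'
      rw [this]
      exact hW (m_in x h')
    · rw [f_out x h']
      exact hW (m_out x h' hx)
  have fT : MapsTo f (sphere 0 1) T := by
    intro x hx
    have hx' : ‖x‖ = 1 := by simpa using hx
    rw [f_out x (by rw [hx']; norm_num), hx']
    norm_num
    exact hT x hx
  obtain ⟨g, ⟨H, Hc, H0, H1, HW, HT⟩, hg⟩ := hc f fcont fW fT
  -- The map `(t, x) ↦ (s t ‖x‖, r t ‖x‖ • x)` bends the cylinder over the cube onto the cylinder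
  -- over the big cube: the bottom goes to the inner half of the bottom, the sides to the rest of
  -- the bottom, and the top to the top and the sides.
  set s : ℝ → ℝ → ℝ := fun t ρ => t * min 1 (2 - 2 * ρ) with hs
  set r : ℝ → ℝ → ℝ := fun t ρ => 1 / 2 * min (1 + 3 * t) ((1 + t) / max ρ (1 / 4)) with hr
  have s_mem : ∀ t ∈ Icc (0 : ℝ) 1, ∀ ρ : ℝ, ρ ≤ 1 → s t ρ ∈ Icc (0 : ℝ) 1 := by
    intro t ht ρ hρ
    have h0 : 0 ≤ min 1 (2 - 2 * ρ) := le_min zero_le_one (by linarith)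
    have h1 : min 1 (2 - 2 * ρ) ≤ 1 := min_le_left _ _
    exact ⟨mul_nonneg ht.1 h0, mul_le_one₀ ht.2 h0 h1⟩
  have r_nonneg : ∀ t ∈ Icc (0 : ℝ) 1, ∀ ρ : ℝ, 0 ≤ r t ρ := by
    intro t ht ρ
    have : (0 : ℝ) < max ρ (1 / 4) := lt_max_of_lt_right (by norm_num)
    have := ht.1
    simp only [hr]
    positivity
  have r_mem : ∀ t ∈ Icc (0 : ℝ) 1, ∀ x : ι → ℝ, ‖x‖ ≤ 1 → ‖r t ‖x‖ • x‖ ≤ 1 := by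
    intro t ht x hx
    rw [norm_smul, Real.norm_of_nonneg (r_nonneg t ht _)]
    rcases le_total ‖x‖ (1 / 4) with h' | h'
    · have : r t ‖x‖ ≤ 1 / 2 * (1 + 3 * t) := by
        simp only [hr]; gcongr; exact min_le_left _ _
      have h3 : r t ‖x‖ ≤ 2 := by linarith [ht.2]
      nlinarith [norm_nonneg x]
    · have : r t ‖x‖ ≤ 1 / 2 * ((1 + t) / ‖x‖) := by
        simp only [hr, max_eq_left h']; gcongr; exact min_le_right _ _
      calc r t ‖x‖ * ‖x‖ ≤ 1 / 2 * ((1 + t) / ‖x‖) * ‖x‖ := by gcongr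
        _ = (1 + t) / 2 := by field_simp
        _ ≤ 1 := by linarith [ht.2]
  have mem : ∀ p ∈ (Icc (0 : ℝ) 1 ×ˢ closedBall (0 : ι → ℝ) 1),
      (s p.1 ‖p.2‖, r p.1 ‖p.2‖ • p.2) ∈ (Icc (0 : ℝ) 1 ×ˢ closedBall (0 : ι → ℝ) 1) := by
    rintro ⟨t, x⟩ ⟨ht, hx⟩
    have hx' : ‖x‖ ≤ 1 := by simpa using hx
    exact ⟨s_mem t ht _ hx', by simpa using r_mem t ht x hx'⟩
  refine ⟨fun p => H (s p.1 ‖p.2‖, r p.1 ‖p.2‖ • p.2), ?_, ?_, ?_, ?_⟩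
  · refine Hc.comp ?_ mem
    refine Continuous.continuousOn ?_
    have hm : ∀ p : ℝ × (ι → ℝ), max ‖p.2‖ (1 / 4) ≠ 0 := fun p =>
      (lt_max_of_lt_right (by norm_num)).ne'
    simp only [hs, hr]
    refine Continuous.prodMk (by fun_prop) (Continuous.fun_smul ?_ continuous_snd)
    refine continuous_const.mul (Continuous.min (by fun_prop) (Continuous.div ?_ ?_ hm)) <;> fun_prop
  · rintro ⟨t, x⟩ (⟨ht, hx⟩ | ⟨ht, hx⟩)
    · have hx' : ‖x‖ ≤ 1 := by simpa using hx
      obtain rfl : t = 0 := ht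
      have e1 : s 0 ‖x‖ = 0 := by simp [hs]
      have e2 : r 0 ‖x‖ = 1 / 2 := by
        simp only [hr]
        rw [min_eq_left]
        · norm_num
        · rw [le_div_iff₀ (lt_max_of_lt_right (by norm_num))]
          have : max ‖x‖ (1 / 4) ≤ 1 := max_le hx' (by norm_num)
          linarith
      have e3 : ‖((1 / 2 : ℝ) • x)‖ ≤ 1 / 2 := by
        rw [norm_smul, Real.norm_of_nonneg (by norm_num)]; linarith
      dsimp only
      rw [e1, e2, H0 _ (by rw [mem_closedBall, dist_zero_right]; linarith)]
      have : f ((1 / 2 : ℝ) • x) = h (0, (2 : ℝ) • ((1 / 2 : ℝ) • x)) := if_pos e3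
      rw [this, smul_smul]
      norm_num
    · have hx' : ‖x‖ = 1 := by simpa using hx
      have e1 : s t ‖x‖ = 0 := by simp [hs, hx']
      have e2 : r t ‖x‖ = (1 + t) / 2 := by
        simp only [hr, hx']
        rw [min_eq_right]
        · norm_num; ring
        · norm_num; linarith [ht.1]
      have ht' : (0 : ℝ) ≤ t := ht.1
      have ht1 : t ≤ 1 := ht.2
      have e3 : ‖(((1 + t) / 2 : ℝ) • x)‖ = (1 + t) / 2 := by
        rw [norm_smul, Real.norm_of_nonneg (by linarith), hx', mul_one]
      dsimp only
      rw [e1, e2, H0 _ (by rw [mem_closedBall, dist_zero_right]; linarith),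
        f_out _ (by linarith), e3, smul_smul, inv_mul_cancel₀ (by linarith), one_smul]
      congr 2
      ring
  · exact fun p hp => HW (mem p hp)
  · intro x hx
    have hx' : ‖x‖ ≤ 1 := by simpa using hx
    have h1 : (1 : ℝ) ∈ Icc (0 : ℝ) 1 := ⟨zero_le_one, le_rfl⟩
    rcases le_total ‖x‖ (1 / 2) with h' | h'
    · have e1 : s 1 ‖x‖ = 1 := by
        simp only [hs, one_mul]; exact min_eq_left (by linarith)
      have := (mem (1, x) ⟨h1, hx⟩).2
      dsimp only at this ⊢
      rw [e1, H1 _ this]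
      exact hg this
    · have e2 : r 1 ‖x‖ = ‖x‖⁻¹ := by
        simp only [hr]
        rw [max_eq_left (by linarith), min_eq_right]
        · field_simp; norm_num
        · rw [div_le_iff₀ (by linarith)]; linarith
      refine HT ⟨s_mem 1 h1 _ hx', ?_⟩
      simp only [e2, mem_sphere_iff_norm, sub_zero]
      exact nn x h'

/-- Compressions are carried out relative to the boundary, so they can be composed. -/
theorem Compressible.trans {W T S : Set X} (hTW : T ⊆ W) (hST : S ⊆ T)
    (h₁ : Compressible ι W T) (h₂ : Compressible ι T S) : Compressible ι W S := by
  intro f hf hW hS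
  obtain ⟨H, Hc, He, HW, HT⟩ := h₁.fillable (fun p => f p.2)
    (hf.comp continuousOn_snd fun p hp => hp.elim (fun h => h.2)
      fun h => sphere_subset_closedBall h.2)
    (fun p hp => hW (hp.elim (fun h => h.2) fun h => sphere_subset_closedBall h.2))
    (fun x hx => hST (hS hx))
  have h1 : (1 : ℝ) ∈ Icc (0 : ℝ) 1 := ⟨zero_le_one, le_rfl⟩
  obtain ⟨g, ⟨K, Kc, K0, K1, KW, KT⟩, hg⟩ := h₂ (fun x => H (1, x))
    (Hc.comp (by fun_prop) fun x hx => ⟨h1, hx⟩) HT (fun x hx => by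
      have := @He ((1 : ℝ), x) (.inr ⟨h1, hx⟩)
      simp only [this]
      exact hS hx)
  refine ⟨g, PairHomotopic.trans (g := fun x => H (1, x))
    ⟨H, Hc, fun x hx => ?_, fun _ _ => rfl, HW, ?_⟩
    ⟨K, Kc, K0, K1, fun p hp => hTW (KW hp), KT⟩, hg⟩
  · exact He (.inl ⟨rfl, hx⟩)
  · intro p hp
    rw [He (.inr hp)]
    exact hS hp.2

end Compression

/-! ### Cell by cell deformation over an integer grid -/

section Grid

open scoped Classical

/-- The closed cell of the integer grid in `ℝ^ι` with smallest corner `a` and with the finite set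
`s` of directions in which it extends. -/
def gridCell {ι : Type*} (a : ι → ℤ) (s : Finset ι) : Set (ι → ℝ) :=
  {x | ∀ i, (a i : ℝ) ≤ x i ∧ x i ≤ a i + if i ∈ s then 1 else 0}

variable {ι : Type*}

theorem isClosed_gridCell (a : ι → ℤ) (s : Finset ι) : IsClosed (gridCell a s) := by
  have : gridCell a s = ⋂ i, ({x : ι → ℝ | (a i : ℝ) ≤ x i} ∩
      {x : ι → ℝ | x i ≤ a i + if i ∈ s then 1 else 0}) := by
    ext x; simp [gridCell]
  rw [this]
  exact isClosed_iInter fun i => (isClosed_le continuous_const (continuous_apply i)).inter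
    (isClosed_le (continuous_apply i) continuous_const)

theorem corner_mem_gridCell (a : ι → ℤ) (s : Finset ι) : (fun i => (a i : ℝ)) ∈ gridCell a s := by
  intro i
  refine ⟨le_rfl, ?_⟩
  dsimp only
  split_ifs <;> linarith

theorem top_corner_mem_gridCell (a : ι → ℤ) (s : Finset ι) :
    (fun i => (a i : ℝ) + if i ∈ s then 1 else 0) ∈ gridCell a s := by
  intro i
  refine ⟨?_, le_rfl⟩
  dsimp only
  split_ifs <;> linarith

/-- The affine parametrization of a grid cell by the cube `[-1, 1]^s`. -/
noncomputable def cellParam (a : ι → ℤ) (s : Finset ι) (y : s → ℝ) (i : ι) : ℝ :=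
  if h : i ∈ s then a i + (y ⟨i, h⟩ + 1) / 2 else a i

/-- The coordinates on a grid cell with respect to `cellParam`. -/
noncomputable def cellCoord (a : ι → ℤ) (s : Finset ι) (x : ι → ℝ) (j : s) : ℝ :=
  2 * (x j - a j) - 1

theorem continuous_cellParam (a : ι → ℤ) (s : Finset ι) : Continuous (cellParam a s) := by
  refine continuous_pi fun i => ?_
  unfold cellParam
  split_ifs <;> fun_prop

theorem continuous_cellCoord (a : ι → ℤ) (s : Finset ι) : Continuous (cellCoord a s) := by
  refine continuous_pi fun i => ?_
  unfold cellCoord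
  fun_prop

theorem cellParam_mem {a : ι → ℤ} {s : Finset ι} {y : s → ℝ} (hy : y ∈ closedBall 0 1) :
    cellParam a s y ∈ gridCell a s := by
  rw [mem_closedBall, dist_zero_right, pi_norm_le_iff_of_nonneg zero_le_one] at hy
  intro i
  unfold cellParam
  split_ifs with h
  · have := abs_le.1 (Real.norm_eq_abs _ ▸ hy ⟨i, h⟩)
    constructor <;> linarith
  · simp

theorem cellCoord_mem {a : ι → ℤ} {s : Finset ι} {x : ι → ℝ} (hx : x ∈ gridCell a s) :
    cellCoord a s x ∈ closedBall 0 1 := by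
  rw [mem_closedBall, dist_zero_right, pi_norm_le_iff_of_nonneg zero_le_one]
  intro j
  have := hx j
  simp only [j.2, if_true] at this
  rw [Real.norm_eq_abs, abs_le]
  unfold cellCoord
  constructor <;> linarith

theorem cellParam_cellCoord {a : ι → ℤ} {s : Finset ι} {x : ι → ℝ} (hx : x ∈ gridCell a s) :
    cellParam a s (cellCoord a s x) = x := by
  funext i
  unfold cellParam cellCoord
  split_ifs with h
  · ring
  · have := hx i
    simp only [h, if_false, add_zero] at this
    exact le_antisymm this.1 this.2

/-- A map is continuous on a product with a set that is covered by finitely many cells if it is so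
on the product with each of these cells. -/
theorem continuousOn_prod_of_gridCell {X : Type*} [TopologicalSpace X] {J : Set ℝ}
    (hJ : IsClosed J) {H : ℝ × (ι → ℝ) → X} {C : Set ((ι → ℤ) × Finset ι)} (hC : C.Finite)
    {S : Set (ι → ℝ)} (hS : ∀ x ∈ S, ∃ c ∈ C, x ∈ gridCell c.1 c.2)
    (h : ∀ c ∈ C, ContinuousOn H (J ×ˢ gridCell c.1 c.2)) : ContinuousOn H (J ×ˢ S) := by
  have := hC.to_subtype
  have h1 : ContinuousOn H (⋃ c : C, J ×ˢ gridCell c.1.1 c.1.2) :=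
    (locallyFinite_of_finite _).continuousOn_iUnion
      (fun c => hJ.prod (isClosed_gridCell _ _)) fun c => h c c.2
  refine h1.mono ?_
  rintro ⟨t, x⟩ ⟨ht, hx⟩
  obtain ⟨c, hc, hxc⟩ := hS x hx
  exact mem_iUnion.2 ⟨⟨c, hc⟩, ht, hxc⟩

variable [Fintype ι]

/-- The directions in which the open cell containing `x` extends. -/
noncomputable def activeDir (x : ι → ℝ) : Finset ι := {i | ((⌊x i⌋ : ℤ) : ℝ) ≠ x i}

theorem mem_activeDir {x : ι → ℝ} {i : ι} : i ∈ activeDir x ↔ ((⌊x i⌋ : ℤ) : ℝ) ≠ x i := by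
  simp [activeDir]

theorem mem_gridCell_floor (x : ι → ℝ) : x ∈ gridCell (fun i => ⌊x i⌋) (activeDir x) := by
  intro i
  refine ⟨Int.floor_le _, ?_⟩
  by_cases h : i ∈ activeDir x
  · simpa [h] using (Int.lt_floor_add_one (x i)).le
  · simp only [h, if_false, add_zero]
    rw [mem_activeDir, not_not] at h
    exact h.ge

theorem activeDir_subset {a : ι → ℤ} {s : Finset ι} {x : ι → ℝ} (hx : x ∈ gridCell a s) :
    activeDir x ⊆ s := by
  intro i hi
  by_contra h
  have := hx i
  simp only [h, if_false, add_zero] at this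
  have e : x i = a i := le_antisymm this.2 this.1
  rw [mem_activeDir, e] at hi
  simp at hi

theorem gridCell_floor_subset {a : ι → ℤ} {s : Finset ι} {x : ι → ℝ} (hx : x ∈ gridCell a s) :
    gridCell (fun i => ⌊x i⌋) (activeDir x) ⊆ gridCell a s := by
  intro y hy i
  have h1 : a i ≤ ⌊x i⌋ := Int.le_floor.2 (hx i).1
  have h1' : (a i : ℝ) ≤ ⌊x i⌋ := by exact_mod_cast h1
  refine ⟨h1'.trans (hy i).1, (hy i).2.trans ?_⟩
  by_cases h : i ∈ activeDir x
  · have hs := activeDir_subset hx h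
    have h2 := (hx i).2
    have h3 := (mem_activeDir.1 h).lt_of_le (Int.floor_le _)
    simp only [hs, if_true] at h2
    have h4 : (⌊x i⌋ : ℝ) < ((a i + 1 : ℤ) : ℝ) := by push_cast; linarith
    have h5 : ⌊x i⌋ ≤ a i := by have := Int.cast_lt.1 h4; omega
    have h5' : (⌊x i⌋ : ℝ) ≤ a i := by exact_mod_cast h5
    simp only [h, hs, if_true]
    linarith
  · simp only [h, if_false, add_zero]
    rw [mem_activeDir, not_not] at h
    rw [h]
    exact (hx i).2

theorem floor_eq_of_activeDir_eq {a : ι → ℤ} {s : Finset ι} {x : ι → ℝ} (hx : x ∈ gridCell a s)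
    (h : activeDir x = s) : (fun i => ⌊x i⌋) = a := by
  funext i
  have h1 := gridCell_floor_subset hx (corner_mem_gridCell _ _) i
  have h2 := gridCell_floor_subset hx (top_corner_mem_gridCell _ _) i
  have h3 : (⌊x i⌋ : ℝ) ≤ a i := by
    have := h2.2
    rw [h] at this
    linarith
  exact le_antisymm (by exact_mod_cast h3) (by exact_mod_cast h1.1)

/-- A cell of the integer grid is contained in a cube with integer half-width as soon as one point
of the open cell is. -/
theorem gridCell_floor_subset_closedBall {L : ℕ} {x : ι → ℝ} (hx : x ∈ closedBall 0 (L : ℝ)) :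
    gridCell (fun i => ⌊x i⌋) (activeDir x) ⊆ closedBall 0 (L : ℝ) := by
  rw [mem_closedBall, dist_zero_right, pi_norm_le_iff_of_nonneg (by positivity)] at hx
  intro y hy
  rw [mem_closedBall, dist_zero_right, pi_norm_le_iff_of_nonneg (by positivity)]
  intro i
  have hxi := abs_le.1 (Real.norm_eq_abs _ ▸ hx i)
  rw [Real.norm_eq_abs, abs_le]
  have h1 : (-(L : ℤ)) ≤ ⌊x i⌋ := Int.le_floor.2 (by push_cast; exact hxi.1)
  have h1' : -(L : ℝ) ≤ ⌊x i⌋ := by exact_mod_cast h1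
  refine ⟨h1'.trans (hy i).1, (hy i).2.trans ?_⟩
  by_cases h : i ∈ activeDir x
  · have h3 := (mem_activeDir.1 h).lt_of_le (Int.floor_le _)
    have h4 : (⌊x i⌋ : ℝ) < ((L : ℤ) : ℝ) := by push_cast; linarith
    have h5 : ⌊x i⌋ + 1 ≤ (L : ℤ) := by have := Int.cast_lt.1 h4; omega
    simp only [h, if_true]
    exact_mod_cast h5
  · simp only [h, if_false, add_zero]
    rw [mem_activeDir, not_not] at h
    rw [h]
    exact hxi.2

theorem activeDir_cellParam_ne {a : ι → ℤ} {s : Finset ι} {y : s → ℝ} (hy : y ∈ sphere 0 1) :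
    activeDir (cellParam a s y) ≠ s := by
  have hy' : ‖y‖ = 1 := by simpa using hy
  obtain ⟨j, hj⟩ : ∃ j, ‖y j‖ = 1 := by
    by_contra! h
    have h1 : ∀ j, ‖y j‖ < 1 := fun j =>
      lt_of_le_of_ne (hy' ▸ norm_le_pi_norm y j) (h j)
    exact ((pi_norm_lt_iff zero_lt_one).2 h1).ne hy'
  intro h
  have hm : (j : ι) ∈ activeDir (cellParam a s y) := by rw [h]; exact j.2
  rw [mem_activeDir] at hm
  simp only [cellParam, j.2, dif_pos] at hm
  rw [Real.norm_eq_abs] at hj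
  rcases eq_or_eq_neg_of_abs_eq hj with h | h
  · apply hm
    have e : (a j : ℝ) + (y j + 1) / 2 = ((a j + 1 : ℤ) : ℝ) := by rw [h]; push_cast; ring
    have e' : (a j : ℝ) + (y ⟨(j : ι), j.2⟩ + 1) / 2 = ((a j + 1 : ℤ) : ℝ) := e
    rw [e', Int.floor_intCast]
  · apply hm
    have e : (a j : ℝ) + (y j + 1) / 2 = ((a j : ℤ) : ℝ) := by rw [h]; ring
    have e' : (a j : ℝ) + (y ⟨(j : ι), j.2⟩ + 1) / 2 = ((a j : ℤ) : ℝ) := e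
    rw [e', Int.floor_intCast]

theorem cellCoord_mem_sphere {a : ι → ℤ} {s : Finset ι} {x : ι → ℝ} (hx : x ∈ gridCell a s)
    (h : activeDir x ≠ s) : cellCoord a s x ∈ sphere 0 1 := by
  obtain ⟨i, his, hi⟩ : ∃ i ∈ s, i ∉ activeDir x := by
    by_contra! h'
    exact h ((activeDir_subset hx).antisymm h')
  rw [mem_activeDir, not_not] at hi
  have hle : ‖cellCoord a s x‖ ≤ 1 := by simpa using cellCoord_mem hx
  have h1 := hx i
  simp only [his, if_true] at h1
  have h2 : a i ≤ ⌊x i⌋ := Int.le_floor.2 h1.1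
  have h3 : ⌊x i⌋ ≤ a i + 1 := by
    have : (⌊x i⌋ : ℝ) ≤ ((a i + 1 : ℤ) : ℝ) := by rw [hi]; push_cast; exact h1.2
    exact_mod_cast this
  have h4 : ‖cellCoord a s x ⟨i, his⟩‖ = 1 := by
    have e : cellCoord a s x ⟨i, his⟩ = 2 * ((⌊x i⌋ : ℝ) - a i) - 1 := by rw [hi]; rfl
    rw [e]
    rcases (by omega : ⌊x i⌋ = a i ∨ ⌊x i⌋ = a i + 1) with h | h <;> rw [h] <;> norm_num
  rw [mem_sphere_iff_norm, sub_zero]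
  exact le_antisymm hle (h4 ▸ norm_le_pi_norm _ _)

theorem finite_gridCell_subset {S : Set (ι → ℝ)} (hS : Bornology.IsBounded S) :
    {c : (ι → ℤ) × Finset ι | gridCell c.1 c.2 ⊆ S}.Finite := by
  obtain ⟨R, hR⟩ := hS.subset_closedBall 0
  have : {c : (ι → ℤ) × Finset ι | gridCell c.1 c.2 ⊆ S} ⊆
      (Icc (fun _ => -⌈R⌉) (fun _ => ⌈R⌉)) ×ˢ univ := by
    rintro ⟨a, s⟩ h
    have h1 := hR (h (corner_mem_gridCell a s))
    rw [mem_closedBall, dist_zero_right] at h1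
    have h2 : ∀ i, |(a i : ℝ)| ≤ ⌈R⌉ := fun i =>
      ((norm_le_pi_norm (fun i => (a i : ℝ)) i).trans h1).trans (Int.le_ceil R)
    refine ⟨⟨fun i => ?_, fun i => ?_⟩, mem_univ _⟩
    · exact_mod_cast (abs_le.1 (h2 i)).1
    · exact_mod_cast (abs_le.1 (h2 i)).2
  exact ((finite_Icc _ _).prod finite_univ).subset this

/-- Deformation of a map of a cube subdivided by the integer grid, cell by cell. The
deformation of a cell `C` takes place in `W C` and ends in `T C`, and is found on one skeleton
after the other. -/
theorem exists_homotopy_of_gridCell {X : Type*} [TopologicalSpace X] (L : ℕ)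
    {W T : Set (ι → ℝ) → Set X} (hWm : Monotone W) (hTm : Monotone T)
    (hfill : ∀ (a : ι → ℤ) (s : Finset ι), gridCell a s ⊆ closedBall 0 L →
      Fillable s (W (gridCell a s)) (T (gridCell a s)))
    {f : (ι → ℝ) → X} (hf : ContinuousOn f (closedBall 0 L))
    (hfW : ∀ (a : ι → ℤ) (s : Finset ι), gridCell a s ⊆ closedBall 0 L →
      MapsTo f (gridCell a s) (W (gridCell a s))) :
    ∃ H : ℝ × (ι → ℝ) → X, ContinuousOn H (Icc 0 1 ×ˢ closedBall 0 L) ∧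
      (∀ x ∈ closedBall (0 : ι → ℝ) L, H (0, x) = f x) ∧
      ∀ (a : ι → ℤ) (s : Finset ι), gridCell a s ⊆ closedBall 0 L →
        MapsTo H (Icc 0 1 ×ˢ gridCell a s) (W (gridCell a s)) ∧
        ∀ x ∈ gridCell a s, H (1, x) ∈ T (gridCell a s) := by
  have h1 : (1 : ℝ) ∈ Icc (0 : ℝ) 1 := ⟨zero_le_one, le_rfl⟩
  have skel : ∀ n : ℕ, ∃ H : ℝ × (ι → ℝ) → X,
      (∀ x ∈ closedBall (0 : ι → ℝ) L, H (0, x) = f x) ∧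
      ∀ (a : ι → ℤ) (s : Finset ι), gridCell a s ⊆ closedBall 0 L → s.card < n →
        ContinuousOn H (Icc 0 1 ×ˢ gridCell a s) ∧
        MapsTo H (Icc 0 1 ×ˢ gridCell a s) (W (gridCell a s)) ∧
        ∀ x ∈ gridCell a s, H (1, x) ∈ T (gridCell a s) := by
    intro n
    induction n with
    | zero => exact ⟨fun p => f p.2, fun _ _ => rfl, fun _ _ _ h => absurd h (Nat.not_lt_zero _)⟩
    | succ n ih =>
      obtain ⟨H, H0, Hs⟩ := ih
      -- the extension over a single cell of dimension `n`
      have ext : ∀ (a : ι → ℤ) (s : Finset ι), ∃ K : ℝ × (s → ℝ) → X,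
          gridCell a s ⊆ closedBall 0 L → s.card = n →
          ContinuousOn K (Icc 0 1 ×ˢ closedBall 0 1) ∧
          EqOn K (fun p => H (p.1, cellParam a s p.2))
            ({0} ×ˢ closedBall 0 1 ∪ Icc 0 1 ×ˢ sphere 0 1) ∧
          MapsTo K (Icc 0 1 ×ˢ closedBall 0 1) (W (gridCell a s)) ∧
          ∀ y ∈ closedBall (0 : s → ℝ) 1, K (1, y) ∈ T (gridCell a s) := by
        intro a s
        by_cases has : gridCell a s ⊆ closedBall 0 L ∧ s.card = n
        swap
        · exact ⟨fun p => H (p.1, cellParam a s p.2), fun h h' => absurd ⟨h, h'⟩ has⟩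
        obtain ⟨has, hsn⟩ := has
        have lower : ∀ x ∈ gridCell a s, activeDir x ≠ s →
            (gridCell (fun i => ⌊x i⌋) (activeDir x) ⊆ gridCell a s) ∧
            (activeDir x).card < n := fun x hx hne =>
          ⟨gridCell_floor_subset hx, hsn ▸ Finset.card_lt_card
            ((activeDir_subset hx).ssubset_of_ne hne)⟩
        have bdry : ContinuousOn H (Icc 0 1 ×ˢ {x | x ∈ gridCell a s ∧ activeDir x ≠ s}) := by
          refine continuousOn_prod_of_gridCell isClosed_Icc
            (C := {c | gridCell c.1 c.2 ⊆ closedBall 0 (L : ℝ) ∧ c.2.card < n})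
            ((finite_gridCell_subset isBounded_closedBall).subset fun c hc => hc.1) ?_
            fun c hc => (Hs c.1 c.2 hc.1 hc.2).1
          rintro x ⟨hx, hne⟩
          exact ⟨(fun i => ⌊x i⌋, activeDir x),
            ⟨(lower x hx hne).1.trans has, (lower x hx hne).2⟩, mem_gridCell_floor x⟩
        have sph : ∀ y ∈ sphere (0 : s → ℝ) 1,
            cellParam a s y ∈ gridCell a s ∧ activeDir (cellParam a s y) ≠ s := fun y hy =>
          ⟨cellParam_mem (sphere_subset_closedBall hy), activeDir_cellParam_ne hy⟩
        refine Exists.imp (fun K hK _ _ => hK)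
          (hfill a s has (fun p => H (p.1, cellParam a s p.2)) ?_ ?_ ?_)
        · refine ContinuousOn.union_of_isClosed ?_ ?_ (isClosed_singleton.prod isClosed_closedBall)
            (isClosed_Icc.prod isClosed_sphere)
          · have : ContinuousOn (fun p : ℝ × (s → ℝ) => f (cellParam a s p.2))
                ({0} ×ˢ closedBall 0 1) :=
              hf.comp ((continuous_cellParam a s).comp continuous_snd).continuousOn
                fun p hp => has (cellParam_mem hp.2)
            refine this.congr ?_
            rintro ⟨t, y⟩ ⟨ht, hy⟩
            obtain rfl : t = 0 := ht
            exact H0 _ (has (cellParam_mem hy))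
          · refine bdry.comp (continuous_fst.prodMk
              ((continuous_cellParam a s).comp continuous_snd)).continuousOn ?_
            exact fun p hp => ⟨hp.1, sph p.2 hp.2⟩
        · rintro ⟨t, y⟩ (⟨ht, hy⟩ | ⟨ht, hy⟩)
          · obtain rfl : t = 0 := ht
            dsimp only
            rw [H0 _ (has (cellParam_mem hy))]
            exact hfW a s has (cellParam_mem hy)
          · obtain ⟨hx, hne⟩ := sph y hy
            obtain ⟨hsub, hcard⟩ := lower _ hx hne
            exact hWm hsub ((Hs _ _ (hsub.trans has) hcard).2.1 ⟨ht, mem_gridCell_floor _⟩)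
        · intro y hy
          obtain ⟨hx, hne⟩ := sph y hy
          obtain ⟨hsub, hcard⟩ := lower _ hx hne
          exact hTm hsub ((Hs _ _ (hsub.trans has) hcard).2.2 _ (mem_gridCell_floor _))
      choose K hK using ext
      obtain ⟨H', hH₁, hH₂⟩ : ∃ H' : ℝ × (ι → ℝ) → X,
          (∀ t x, (activeDir x).card = n → H' (t, x) =
            K (fun i => ⌊x i⌋) (activeDir x)
              (t, cellCoord (fun i => ⌊x i⌋) (activeDir x) x)) ∧
          ∀ t x, (activeDir x).card ≠ n → H' (t, x) = H (t, x) :=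
        ⟨fun p => if (activeDir p.2).card = n then
            K (fun i => ⌊p.2 i⌋) (activeDir p.2)
              (p.1, cellCoord (fun i => ⌊p.2 i⌋) (activeDir p.2) p.2)
          else H p, fun _ _ h => if_pos h, fun _ _ h => if_neg h⟩
      have low : ∀ (a : ι → ℤ) (s : Finset ι), s.card < n →
          EqOn H' H (Icc 0 1 ×ˢ gridCell a s) := by
        rintro a s hs ⟨t, x⟩ ⟨_, hx⟩
        exact hH₂ t x ((Finset.card_le_card (activeDir_subset hx)).trans_lt hs).ne
      have eqn : ∀ (a : ι → ℤ) (s : Finset ι), gridCell a s ⊆ closedBall 0 L → s.card = n →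
          EqOn H' (fun p => K a s (p.1, cellCoord a s p.2)) (Icc 0 1 ×ˢ gridCell a s) := by
        rintro a s has hs ⟨t, x⟩ ⟨ht, hx⟩
        by_cases hx' : activeDir x = s
        · have hfl := floor_eq_of_activeDir_eq hx hx'
          rw [hH₁ t x (hx' ▸ hs)]
          subst hx'
          rw [hfl]
        · have hlt : (activeDir x).card < n :=
            hs ▸ Finset.card_lt_card ((activeDir_subset hx).ssubset_of_ne hx')
          have h2 := @(hK a s has hs).2.1 (t, cellCoord a s x)
            (.inr ⟨ht, cellCoord_mem_sphere hx hx'⟩)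
          dsimp only at h2 ⊢
          rw [hH₂ t x hlt.ne, h2, cellParam_cellCoord hx]
      refine ⟨H', ?_, ?_⟩
      · intro x hx
        by_cases hn : (activeDir x).card = n
        · have has := gridCell_floor_subset_closedBall hx
          have hy := cellCoord_mem (mem_gridCell_floor x)
          rw [hH₁ 0 x hn, (hK _ _ has hn).2.1 (Or.inl (mk_mem_prod (mem_singleton 0) hy))]
          dsimp only
          rw [cellParam_cellCoord (mem_gridCell_floor x), H0 x hx]
        · rw [← H0 x hx]
          exact hH₂ 0 x hn
      · intro a s has hs
        rcases Nat.lt_succ_iff_lt_or_eq.1 hs with hs | hs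
        · obtain ⟨c, hW, hT⟩ := Hs a s has hs
          refine ⟨c.congr (low a s hs), fun p hp => ?_, fun x hx => ?_⟩
          · rw [low a s hs hp]; exact hW hp
          · rw [low a s hs ⟨h1, hx⟩]; exact hT x hx
        · obtain ⟨c, -, hW, hT⟩ := hK a s has hs
          refine ⟨?_, fun p hp => ?_, fun x hx => ?_⟩
          · refine (c.comp (continuous_fst.prodMk
              ((continuous_cellCoord a s).comp continuous_snd)).continuousOn ?_).congr
              (eqn a s has hs)
            exact fun p hp => ⟨hp.1, cellCoord_mem hp.2⟩
          · rw [eqn a s has hs hp]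
            exact hW ⟨hp.1, cellCoord_mem hp.2⟩
          · rw [eqn a s has hs ⟨h1, hx⟩]
            exact hT _ (cellCoord_mem hx)
  obtain ⟨H, H0, Hs⟩ := skel (Fintype.card ι + 1)
  have hlt : ∀ s : Finset ι, s.card < Fintype.card ι + 1 := fun s =>
    Nat.lt_succ_of_le s.card_le_univ
  refine ⟨H, ?_, H0, fun a s has => (Hs a s has (hlt s)).2⟩
  refine continuousOn_prod_of_gridCell isClosed_Icc
    (C := {c | gridCell c.1 c.2 ⊆ closedBall 0 (L : ℝ)})
    (finite_gridCell_subset isBounded_closedBall)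
    (fun x hx => ⟨(fun i => ⌊x i⌋, activeDir x), gridCell_floor_subset_closedBall hx,
      mem_gridCell_floor x⟩)
    fun c hc => (Hs c.1 c.2 hc (hlt _)).1

end Grid

/-! ### Spaces of *-homomorphisms and their supports -/

section Hom

open scoped CStarAlgebra

variable {A A₀ F G : Type*} [NonUnitalCStarAlgebra A] [NonUnitalCStarAlgebra A₀]
  [NonUnitalCStarAlgebra F] [NonUnitalCStarAlgebra G]

/-- The topology of pointwise norm convergence on the set of *-homomorphisms. -/
instance homTopology : TopologicalSpace (A →⋆ₙₐ[ℂ] G) :=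
  TopologicalSpace.induced (fun φ a => φ a) inferInstance

theorem continuousOn_hom_iff {Z : Type*} [TopologicalSpace Z] {h : Z → A →⋆ₙₐ[ℂ] G} {s : Set Z} :
    ContinuousOn h s ↔ ∀ a, ContinuousOn (fun z => h z a) s := by
  have hi : IsInducing (fun (φ : A →⋆ₙₐ[ℂ] G) (a : A) => φ a) := ⟨rfl⟩
  rw [hi.continuousOn_iff, continuousOn_pi]
  rfl

theorem continuous_hom_apply (a : A) : Continuous fun φ : A →⋆ₙₐ[ℂ] G => φ a :=
  (continuous_apply a).comp continuous_induced_dom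

/-- A *-homomorphism defined on the quotient by the kernel of a surjection. -/
theorem exists_hom_of_ker_le {p : A →⋆ₙₐ[ℂ] A₀} (hp : Function.Surjective p)
    (φ : A →⋆ₙₐ[ℂ] G) (h : ∀ a, p a = 0 → φ a = 0) :
    ∃ ψ : A₀ →⋆ₙₐ[ℂ] G, ∀ a, φ a = ψ (p a) := by
  obtain ⟨r, hr⟩ := hp.hasRightInverse
  have key : ∀ a b, p a = p b → φ a = φ b := fun a b hab => by
    rw [← sub_eq_zero, ← map_sub]
    exact h _ (by rw [map_sub, hab, sub_self])
  refine ⟨{ toFun := fun b => φ (r b), map_smul' := fun c x => ?_, map_zero' := ?_,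
            map_add' := fun x y => ?_, map_mul' := fun x y => ?_, map_star' := fun x => ?_ },
    fun a => key _ _ (hr _).symm⟩
  · rw [← map_smul]; exact key _ _ (by simp [hr _])
  · rw [← map_zero φ]; exact key _ _ (by simp [hr _])
  · rw [← map_add]; exact key _ _ (by simp [hr _])
  · rw [← map_mul]; exact key _ _ (by simp [hr _])
  · rw [← map_star]; exact key _ _ (by simp [hr _, map_star])

theorem map_cfcₙ_real (ψ : A →⋆ₙₐ[ℂ] G) {f : ℝ → ℝ} (hf : Continuous f) (hf0 : f 0 = 0) {x : A}
    (hx : IsSelfAdjoint x) : ψ (cfcₙ f x) = cfcₙ f (ψ x) :=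
  NonUnitalStarAlgHomClass.map_cfcₙ (S := ℂ) ψ f x hf.continuousOn hf0
    (map_continuous ψ) hx (hx.map ψ)

theorem exists_one_of_finiteDimensional (F : Type*) [NonUnitalCStarAlgebra F]
    [FiniteDimensional ℂ F] : ∃ e : F, (∀ x, e * x = x) ∧ star e = e := by
  let := CStarAlgebra.spectralOrder F
  have := CStarAlgebra.spectralOrderedRing F
  have : ProperSpace F := FiniteDimensional.proper ℂ F
  have hl := CStarAlgebra.increasingApproximateUnit F
  -- a limit point of an approximate unit, which exists by compactness
  obtain ⟨e, -, he⟩ := (isCompact_closedBall (0 : F) 1).ultrafilter_le_nhds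
    (Ultrafilter.of (CStarAlgebra.approximateUnit F))
    (Filter.le_principal_iff.2 (Ultrafilter.of_le _ hl.closedBall_mem))
  have h1 : ∀ x : F, e * x = x := fun x =>
    tendsto_nhds_unique (((continuous_mul_const x).tendsto e).mono_left he)
      ((hl.tendsto_mul_right x).mono_left (Ultrafilter.of_le _))
  refine ⟨e, h1, ?_⟩
  have h2 : e * star e = star e := h1 _
  calc star e = e * star e := h2.symm
    _ = star (e * star e) := by rw [star_mul, star_star]
    _ = e := by rw [h2, star_star]

variable {K : Type*} [TopologicalSpace K]

/-- Evaluation at a point. -/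
def evalHom (F : Type*) [NonUnitalCStarAlgebra F] (y : K) : C(K, F) →⋆ₙₐ[ℂ] F where
  toFun g := g y
  map_smul' _ _ := rfl
  map_zero' := rfl
  map_add' _ _ := rfl
  map_mul' _ _ := rfl
  map_star' _ := rfl

variable (ρ : A →⋆ₙₐ[ℂ] C(K, F)) (π : A →⋆ₙₐ[ℂ] A₀)

/-- The *-homomorphisms supported in the union of `A₀` and the set `Y`: they kill all elements of
`A` which vanish in `A₀` and whose function part vanishes on `Y`. -/
def supportedOn (G : Type*) [NonUnitalCStarAlgebra G] (Y : Set K) : Set (A →⋆ₙₐ[ℂ] G) :=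
  {φ | ∀ a, π a = 0 → (∀ y ∈ Y, ρ a y = 0) → φ a = 0}

/-- The algebra `A`, with its maps to `C(K, F)` and `A₀`, contains enough elements: the function
part can be altered at will off the closed set `P`. For `K` a cube and `P` its boundary this is
what remains of the pullback property. -/
def IsRelativeTo (P : Set K) : Prop :=
  ∀ a (g : C(K, F)), (∀ y ∈ P, g y = ρ a y) → ∃ a', ρ a' = g ∧ π a' = π a

variable {ρ π}

theorem supportedOn_mono {Y Y' : Set K} (h : Y ⊆ Y') :
    supportedOn ρ π G Y ⊆ supportedOn ρ π G Y' :=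
  fun _ hφ a ha hY => hφ a ha fun y hy => hY y (h hy)

theorem eq_of_mem_supportedOn {Y : Set K} {φ : A →⋆ₙₐ[ℂ] G} (hφ : φ ∈ supportedOn ρ π G Y)
    {a b : A} (h₀ : π a = π b) (h : ∀ y ∈ Y, ρ a y = ρ b y) : φ a = φ b := by
  rw [← sub_eq_zero, ← map_sub]
  refine hφ _ (by rw [map_sub, h₀, sub_self]) fun y hy => ?_
  rw [map_sub, ContinuousMap.sub_apply, h y hy, sub_self]

/-- On elements vanishing in `A₀`, the norm under a *-homomorphism supported in `Y` is bounded by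
the supremum of the function part over `Y`. -/
theorem norm_le_of_mem_supportedOn {Y : Set K} {φ : A →⋆ₙₐ[ℂ] G}
    (hφ : φ ∈ supportedOn ρ π G Y) {b : A} (hb : π b = 0) {c : ℝ} (hc : 0 ≤ c)
    (h : ∀ y ∈ Y, ‖ρ b y‖ ≤ c) : ‖φ b‖ ≤ c := by
  set f : ℝ → ℝ := fun s => max (|s| - c ^ 2) 0 with hf
  have hfc : Continuous f := by fun_prop
  have hf0 : f 0 = 0 := by simp only [hf, abs_zero, zero_sub]; exact max_eq_right (by nlinarith)
  set x : A := star b * b with hx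
  have hxs : IsSelfAdjoint x := .star_mul_self b
  have hzero : φ (cfcₙ f x) = 0 := by
    refine hφ _ ?_ fun y hy => ?_
    · rw [map_cfcₙ_real _ hfc hf0 hxs, hx, map_mul, hb, mul_zero, cfcₙ_apply_zero]
    · have : ρ (cfcₙ f x) y = cfcₙ f (ρ x y) :=
        map_cfcₙ_real ((evalHom F y).comp ρ) hfc hf0 hxs
      rw [this, ← cfcₙ_zero ℝ (ρ x y)]
      refine cfcₙ_congr fun s hs => ?_
      have h1 : ‖s‖ ≤ ‖ρ x y‖ := by
        have hsa : IsSelfAdjoint (ρ x y) := hxs.map ((evalHom F y).comp ρ)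
        have := norm_apply_le_norm_cfcₙ (fun s : ℝ => s) (ρ x y) hs
        rwa [cfcₙ_id' ℝ (ρ x y)] at this
      have h2 : ‖ρ x y‖ = ‖ρ b y‖ * ‖ρ b y‖ := by
        rw [hx, map_mul, map_star]; exact CStarRing.norm_star_mul_self
      have h3 := h y hy
      have h4 : ‖s‖ ≤ c ^ 2 := by nlinarith [norm_nonneg (ρ b y)]
      exact max_eq_right (by rw [Real.norm_eq_abs] at h4; linarith)
  rw [map_cfcₙ_real _ hfc hf0 hxs] at hzero
  have hsa : IsSelfAdjoint (φ x) := hxs.map φ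
  have h5 : ‖φ x‖ ≤ c ^ 2 := by
    rw [← cfcₙ_id' ℝ (φ x)]
    refine norm_cfcₙ_le fun s hs => ?_
    have := norm_apply_le_norm_cfcₙ f (φ x) hs hfc.continuousOn hf0
    rw [hzero, norm_zero, norm_le_zero_iff] at this
    have h6 : |s| - c ^ 2 ≤ 0 := by rw [← this]; exact le_max_left _ _
    rw [Real.norm_eq_abs]; linarith
  have h7 : ‖φ x‖ = ‖φ b‖ * ‖φ b‖ := by
    rw [hx, map_mul, map_star]; exact CStarRing.norm_star_mul_self
  nlinarith [norm_nonneg (φ b)]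

variable [CompactSpace K] [T2Space K] [FiniteDimensional ℂ F]

theorem exists_extension {P Y : Set K} (hA : IsRelativeTo ρ π P) (hY : IsClosed Y) (hPY : P ⊆ Y)
    (a : A) {k : K → F} (hk : ContinuousOn k Y) (hkP : ∀ y ∈ P, k y = ρ a y) :
    ∃ a', (∀ y ∈ Y, ρ a' y = k y) ∧ π a' = π a := by
  have : TietzeExtension F := TietzeExtension.of_tvs ℂ
  obtain ⟨g, hg⟩ := ContinuousMap.exists_restrict_eq hY
    (⟨Y.domRestrict k, continuousOn_iff_continuous_domRestrict.1 hk⟩ : C(Y, F))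
  have hg' : ∀ y ∈ Y, g y = k y := fun y hy => DFunLike.congr_fun hg ⟨y, hy⟩
  obtain ⟨a', h1, h2⟩ := hA a g fun y hy => (hg' y (hPY hy)).trans (hkP y hy)
  exact ⟨a', fun y hy => by rw [h1, hg' y hy], h2⟩

/-- A homotopy of maps of `Y` into `K` which fix `P` moves the *-homomorphisms supported in `Y`,
and does to their supports what it does to the points of `Y`. -/
theorem exists_push {P Y : Set K} (hA : IsRelativeTo ρ π P) (hY : IsClosed Y) (hPY : P ⊆ Y)
    {w : ℝ × K → K} (hw : ContinuousOn w (Icc 0 1 ×ˢ Y))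
    (hwP : ∀ t ∈ Icc (0 : ℝ) 1, ∀ y ∈ P, w (t, y) = y) :
    ∃ T : ℝ × (A →⋆ₙₐ[ℂ] G) → A →⋆ₙₐ[ℂ] G, ContinuousOn T (Icc 0 1 ×ˢ supportedOn ρ π G Y) ∧
      (∀ t ∈ Icc (0 : ℝ) 1, ∀ Y₁ Y₂ : Set K, Y₁ ⊆ Y → (∀ y ∈ Y₁, w (t, y) ∈ Y₂) →
        ∀ φ ∈ supportedOn ρ π G Y₁, T (t, φ) ∈ supportedOn ρ π G Y₂) ∧
      ∀ t ∈ Icc (0 : ℝ) 1, ∀ Y₁ : Set K, Y₁ ⊆ Y → (∀ y ∈ Y₁, w (t, y) = y) →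
        ∀ φ ∈ supportedOn ρ π G Y₁, T (t, φ) = φ := by
  have ext : ∀ t ∈ Icc (0 : ℝ) 1, ∀ a, ∃ a', (∀ y ∈ Y, ρ a' y = ρ a (w (t, y))) ∧ π a' = π a := by
    intro t ht a
    refine exists_extension hA hY hPY a (k := fun y => ρ a (w (t, y))) ?_ fun y hy => by
      rw [hwP t ht y hy]
    exact (map_continuous (ρ a)).comp_continuousOn
      (hw.comp (by fun_prop) fun y hy => ⟨ht, hy⟩)
  have hT : ∀ p : ℝ × (A →⋆ₙₐ[ℂ] G), ∃ ψ : A →⋆ₙₐ[ℂ] G, p.1 ∈ Icc (0 : ℝ) 1 →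
      p.2 ∈ supportedOn ρ π G Y → ∀ a a', (∀ y ∈ Y, ρ a' y = ρ a (w (p.1, y))) → π a' = π a →
        ψ a = p.2 a' := by
    rintro ⟨t, φ⟩
    by_cases hp : t ∈ Icc (0 : ℝ) 1 ∧ φ ∈ supportedOn ρ π G Y
    swap
    · exact ⟨φ, fun h h' => absurd ⟨h, h'⟩ hp⟩
    obtain ⟨ht, hφ⟩ := hp
    choose r hr hr' using ext t ht
    have key : ∀ a a', (∀ y ∈ Y, ρ a' y = ρ a (w (t, y))) → π a' = π a → φ (r a) = φ a' :=
      fun a a' h h' => eq_of_mem_supportedOn hφ ((hr' a).trans h'.symm)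
        fun y hy => (hr a y hy).trans (h y hy).symm
    refine ⟨{ toFun := fun a => φ (r a), map_smul' := fun c x => ?_, map_zero' := ?_,
              map_add' := fun x y => ?_, map_mul' := fun x y => ?_, map_star' := fun x => ?_ },
      fun _ _ => key⟩
    · rw [← map_smul]
      exact key _ _ (fun y hy => by simp [hr x y hy]) (by simp [hr' x])
    · rw [← map_zero φ]
      exact key _ _ (fun y hy => by rw [map_zero]; rfl) rfl
    · rw [← map_add]
      exact key _ _ (fun z hz => by simp [hr x z hz, hr y z hz]) (by simp [hr' x, hr' y])
    · rw [← map_mul]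
      exact key _ _ (fun z hz => by simp [hr x z hz, hr y z hz]) (by simp [hr' x, hr' y])
    · rw [← map_star]
      refine key (star x) (star (r x)) (fun z hz => ?_) (by rw [map_star, map_star, hr'])
      rw [map_star, map_star]
      exact congrArg star (hr x z hz)
  choose T hT using hT
  refine ⟨T, ?_, ?_, ?_⟩
  · rw [continuousOn_hom_iff]
    rintro a ⟨t₀, φ₀⟩ ⟨ht₀, hφ₀⟩
    obtain ⟨a₀, ha₀, ha₀'⟩ := ext t₀ ht₀ a
    rw [ContinuousWithinAt, Metric.tendsto_nhds]
    intro ε hε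
    have unif : ∀ᶠ t in 𝓝 t₀, ∀ y ∈ Y, t ∈ Icc (0 : ℝ) 1 → y ∈ Y →
        ‖ρ a (w (t, y)) - ρ a (w (t₀, y))‖ < ε / 2 := by
      refine hY.isCompact.eventually_forall_of_forall_eventually fun y hy => ?_
      have hc : ContinuousOn (fun p : ℝ × K => ‖ρ a (w p) - ρ a (w (t₀, p.2))‖)
          (Icc 0 1 ×ˢ Y) := by
        refine ContinuousOn.norm (ContinuousOn.sub ((map_continuous (ρ a)).comp_continuousOn hw)
          ((map_continuous (ρ a)).comp_continuousOn (hw.comp (by fun_prop) ?_)))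
        exact fun p hp => ⟨ht₀, hp.2⟩
      have h1 := hc (t₀, y) ⟨ht₀, hy⟩
      have h2 := (h1.eventually (gt_mem_nhds (by simpa using half_pos hε)) :
        ∀ᶠ p in 𝓝[Icc 0 1 ×ˢ Y] (t₀, y), ‖ρ a (w p) - ρ a (w (t₀, p.2))‖ < ε / 2)
      rw [eventually_nhdsWithin_iff] at h2
      filter_upwards [h2] with p hp h3 h4 using hp ⟨h3, h4⟩
    have point : ∀ᶠ φ in 𝓝 φ₀, ‖φ a₀ - φ₀ a₀‖ < ε / 2 := by
      have := (continuous_hom_apply (G := G) a₀).tendsto φ₀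
      rw [Metric.tendsto_nhds] at this
      simpa [dist_eq_norm] using this (ε / 2) (half_pos hε)
    have both := (unif.prod_nhds point)
    rw [eventually_nhdsWithin_iff]
    filter_upwards [both] with ⟨t, φ⟩ ⟨h1, h2⟩ ⟨ht, hφ⟩
    obtain ⟨a₁, ha₁, ha₁'⟩ := ext t ht a
    rw [hT (t, φ) ht hφ a a₁ ha₁ ha₁', hT (t₀, φ₀) ht₀ hφ₀ a a₀ ha₀ ha₀', dist_eq_norm]
    dsimp only at h1 h2 ht hφ ⊢
    have h3 : ‖φ (a₁ - a₀)‖ ≤ ε / 2 := by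
      refine norm_le_of_mem_supportedOn hφ (by rw [map_sub, ha₁', ha₀', sub_self])
        (half_pos hε).le fun y hy => ?_
      rw [map_sub, ContinuousMap.sub_apply, ha₁ y hy, ha₀ y hy]
      exact (h1 y hy ht hy).le
    calc ‖φ a₁ - φ₀ a₀‖ = ‖φ (a₁ - a₀) + (φ a₀ - φ₀ a₀)‖ := by rw [map_sub]; congr 1; abel
      _ ≤ ‖φ (a₁ - a₀)‖ + ‖φ a₀ - φ₀ a₀‖ := norm_add_le _ _
      _ < ε := by linarith
  · intro t ht Y₁ Y₂ hY₁ hw₁₂ φ hφ a ha haY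
    obtain ⟨a₁, ha₁, ha₁'⟩ := ext t ht a
    rw [hT (t, φ) ht (supportedOn_mono hY₁ hφ) a a₁ ha₁ ha₁']
    refine hφ a₁ (ha₁'.trans ha) fun y hy => ?_
    rw [ha₁ y (hY₁ hy)]
    exact haY _ (hw₁₂ y hy)
  · intro t ht Y₁ hY₁ hw₁ φ hφ
    ext a
    obtain ⟨a₁, ha₁, ha₁'⟩ := ext t ht a
    rw [hT (t, φ) ht (supportedOn_mono hY₁ hφ) a a₁ ha₁ ha₁']
    refine eq_of_mem_supportedOn hφ ha₁' fun y hy => ?_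
    rw [ha₁ y (hY₁ hy), hw₁ y hy]

end Hom

/-! ### Geometry of the cube -/

section Cube

variable {ι : Type*} [Fintype ι]

theorem exists_norm_apply_eq {r : ℝ} (hr : 0 < r) {x : ι → ℝ} (hx : ‖x‖ = r) :
    ∃ j, ‖x j‖ = r := by
  by_contra! h
  exact ((pi_norm_lt_iff hr).2 fun j => lt_of_le_of_ne (hx ▸ norm_le_pi_norm x j) (h j)).ne hx

theorem gridCell_floor_subset_sphere {L : ℕ} (hL : 0 < L) {x : ι → ℝ} (hx : x ∈ sphere 0 (L : ℝ)) :
    gridCell (fun i => ⌊x i⌋) (activeDir x) ⊆ sphere 0 (L : ℝ) := by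
  intro y hy
  have hle := gridCell_floor_subset_closedBall (sphere_subset_closedBall hx) hy
  rw [mem_closedBall, dist_zero_right] at hle
  rw [mem_sphere_iff_norm, sub_zero] at hx ⊢
  obtain ⟨j, hj⟩ := exists_norm_apply_eq (by exact_mod_cast hL) hx
  have hint : ((⌊x j⌋ : ℤ) : ℝ) = x j := by
    rw [Real.norm_eq_abs] at hj
    rcases eq_or_eq_neg_of_abs_eq hj with h | h
    · rw [h, Int.floor_natCast, Int.cast_natCast]
    · have : x j = ((-(L : ℤ) : ℤ) : ℝ) := by rw [h]; push_cast; rfl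
      rw [this, Int.floor_intCast]
  have hna : j ∉ activeDir x := by rw [mem_activeDir, not_not]; exact hint
  have hyj := hy j
  simp only [hna, if_false, add_zero] at hyj
  have e : y j = x j := by rw [← hint]; exact le_antisymm hyj.2 hyj.1
  refine le_antisymm hle ?_
  rw [← hj, ← e]
  exact norm_le_pi_norm y j

theorem card_lt_of_gridCell_subset_sphere {a : ι → ℤ} {s : Finset ι}
    (h : gridCell a s ⊆ sphere 0 1) : s.card < Fintype.card ι := by
  refine (Finset.card_lt_iff_ne_univ s).2 ?_
  rintro rfl
  -- the midpoint of a cell of full dimension has no integral coordinate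
  have hm : (fun i => (a i : ℝ) + 1 / 2) ∈ gridCell a Finset.univ := fun i =>
    ⟨by dsimp only; linarith, by simp only [Finset.mem_univ, if_true]; linarith⟩
  have hn := h hm
  rw [mem_sphere_iff_norm, sub_zero] at hn
  obtain ⟨j, hj⟩ := exists_norm_apply_eq zero_lt_one hn
  rw [Real.norm_eq_abs] at hj
  rcases eq_or_eq_neg_of_abs_eq hj with h | h
  · have : ((2 * a j : ℤ) : ℝ) = ((1 : ℤ) : ℝ) := by push_cast; linarith
    have := Int.cast_injective this
    omega
  · have : ((2 * a j : ℤ) : ℝ) = ((-3 : ℤ) : ℝ) := by push_cast; linarith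
    have := Int.cast_injective this
    omega

theorem norm_sub_le_of_mem_gridCell {a : ι → ℤ} {s : Finset ι} {x y : ι → ℝ}
    (hx : x ∈ gridCell a s) (hy : y ∈ gridCell a s) : ‖x - y‖ ≤ 1 := by
  rw [pi_norm_le_iff_of_nonneg zero_le_one]
  intro i
  have h1 := hx i
  have h2 := hy i
  rw [Pi.sub_apply, Real.norm_eq_abs, abs_le]
  split_ifs at h1 h2 <;> constructor <;> linarith

theorem norm_eq_max_head_tail {d : ℕ} (v : Fin (d + 1) → ℝ) : ‖v‖ = max ‖v 0‖ ‖Fin.tail v‖ := by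
  refine le_antisymm ((pi_norm_le_iff_of_nonneg (le_max_of_le_left (norm_nonneg _))).2 ?_)
    (max_le (norm_le_pi_norm v 0) ((pi_norm_le_iff_of_nonneg (norm_nonneg _)).2
      fun i => norm_le_pi_norm v i.succ))
  intro i
  refine Fin.cases (le_max_left _ _) (fun j => ?_) i
  exact (norm_le_pi_norm (Fin.tail v) j).trans (le_max_right _ _)

theorem norm_cons {d : ℕ} (t : ℝ) (z : Fin d → ℝ) :
    ‖(Fin.cons t z : Fin (d + 1) → ℝ)‖ = max ‖t‖ ‖z‖ := by
  rw [norm_eq_max_head_tail, Fin.cons_zero, Fin.tail_cons]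

/-- The deformation of the unit ball which in the end sends all points of norm at least `ε`
radially to the unit sphere. -/
noncomputable def stretch (ε : ℝ) (p : ℝ × (ι → ℝ)) : ι → ℝ :=
  ((1 - p.1) + p.1 / max ‖p.2‖ ε) • p.2

variable {ε : ℝ}

theorem continuous_stretch (hε : 0 < ε) : Continuous (stretch ε : ℝ × (ι → ℝ) → ι → ℝ) := by
  have : ∀ p : ℝ × (ι → ℝ), max ‖p.2‖ ε ≠ 0 := fun p => (lt_max_of_lt_right hε).ne'
  unfold stretch
  exact Continuous.fun_smul (by fun_prop (disch := exact this)) continuous_snd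

theorem stretch_zero (v : ι → ℝ) : stretch ε (0, v) = v := by simp [stretch]

theorem stretch_of_norm_eq_one (hε1 : ε ≤ 1) (t : ℝ) {v : ι → ℝ} (hv : ‖v‖ = 1) :
    stretch ε (t, v) = v := by
  simp [stretch, hv, max_eq_left hε1]

theorem norm_stretch (hε : 0 < ε) {t : ℝ} (ht : t ∈ Icc (0 : ℝ) 1) (v : ι → ℝ) :
    ‖stretch ε (t, v)‖ = (1 - t) * ‖v‖ + t * (‖v‖ / max ‖v‖ ε) := by
  have h1 : 0 < max ‖v‖ ε := lt_max_of_lt_right hε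
  have h2 : 0 ≤ 1 - t := by linarith [ht.2]
  have h3 := ht.1
  rw [stretch, norm_smul, Real.norm_of_nonneg (by positivity)]
  ring

theorem norm_stretch_le (hε : 0 < ε) {t : ℝ} (ht : t ∈ Icc (0 : ℝ) 1) {v : ι → ℝ}
    (hv : ‖v‖ ≤ 1) : ‖stretch ε (t, v)‖ ≤ 1 := by
  rw [norm_stretch hε ht]
  have : ‖v‖ / max ‖v‖ ε ≤ 1 := div_le_one_of_le₀ (le_max_left _ _) (le_max_of_le_right hε.le)
  nlinarith [ht.1, ht.2]

theorem le_norm_stretch (hε : 0 < ε) (hε1 : ε ≤ 1) {t : ℝ} (ht : t ∈ Icc (0 : ℝ) 1) {v : ι → ℝ}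
    (hv : ‖v‖ ≤ 1) : ‖v‖ ≤ ‖stretch ε (t, v)‖ := by
  rw [norm_stretch hε ht]
  have : ‖v‖ ≤ ‖v‖ / max ‖v‖ ε :=
    le_div_self (norm_nonneg _) (lt_max_of_lt_right hε) (max_le hv hε1)
  nlinarith [ht.1, ht.2]

theorem norm_stretch_one (hε : 0 < ε) {v : ι → ℝ} (hv : ε ≤ ‖v‖) : ‖stretch ε (1, v)‖ = 1 := by
  rw [norm_stretch hε ⟨zero_le_one, le_rfl⟩, max_eq_left hv, div_self (by linarith)]
  ring

end Cube

section Pair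

variable {X : Type*} [TopologicalSpace X] {ι : Type*} [Fintype ι] {W T T' : Set X}
  {f g : (ι → ℝ) → X}

theorem PairHomotopic.mono (h : PairHomotopic W T f g) (hT : T ⊆ T') : PairHomotopic W T' f g := by
  obtain ⟨H, hc, h0, h1, hW, hT'⟩ := h
  exact ⟨H, hc, h0, h1, hW, fun p hp => hT (hT' hp)⟩

theorem PairHomotopic.continuousOn_right (h : PairHomotopic W T f g) :
    ContinuousOn g (closedBall 0 1) := by
  obtain ⟨H, hc, h0, h1, -⟩ := h
  exact (hc.comp (f := fun x => ((1 : ℝ), x)) (by fun_prop)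
    fun x hx => ⟨⟨zero_le_one, le_rfl⟩, hx⟩).congr fun x hx => (h1 x hx).symm

theorem PairHomotopic.mapsTo_right (h : PairHomotopic W T f g) :
    MapsTo g (closedBall 0 1) W := by
  obtain ⟨H, hc, h0, h1, hW, -⟩ := h
  exact fun x hx => h1 x hx ▸ hW ⟨⟨zero_le_one, le_rfl⟩, hx⟩

end Pair

/-! ### Cells, and pushing supports along deformations of cells -/

section Cell

variable {A A₀ F G : Type*} [NonUnitalCStarAlgebra A] [NonUnitalCStarAlgebra A₀]
  [NonUnitalCStarAlgebra F] [NonUnitalCStarAlgebra G] [FiniteDimensional ℂ F]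
  {K : Type*} [TopologicalSpace K] [CompactSpace K] [T2Space K]
  {ρ : A →⋆ₙₐ[ℂ] C(K, F)} {π : A →⋆ₙₐ[ℂ] A₀} {P : Set K}

/-- If the set `Y` is the union of a closed set `Q` and a ball `e(B)`, then a deformation of
the ball, fixed where it meets `Q`, deforms the maps of a cube into the space of
*-homomorphisms supported in `Y`. -/
theorem exists_pairHomotopic_push (hA : IsRelativeTo ρ π P) {Q : Set K} (hQ : IsClosed Q)
    (hPQ : P ⊆ Q) {d : ℕ} {e : (Fin d → ℝ) → K} {w : K → Fin d → ℝ} (he : Continuous e)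
    (hw : Continuous w) (hwe : ∀ v ∈ closedBall (0 : Fin d → ℝ) 1, w (e v) = v)
    {s : ℝ × (Fin d → ℝ) → Fin d → ℝ} (hs : Continuous s)
    (hs_ball : ∀ t ∈ Icc (0 : ℝ) 1, ∀ v ∈ closedBall (0 : Fin d → ℝ) 1, s (t, v) ∈ closedBall 0 1)
    (hs_fix : ∀ t ∈ Icc (0 : ℝ) 1, ∀ v ∈ closedBall (0 : Fin d → ℝ) 1, e v ∈ Q → s (t, v) = v)
    (hs_zero : ∀ v ∈ closedBall (0 : Fin d → ℝ) 1, s (0, v) = v)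
    {B : Set (Fin d → ℝ)} (hB : B ⊆ closedBall 0 1) (hsB : ∀ t ∈ Icc (0 : ℝ) 1, ∀ v ∈ B, s (t, v) ∈ B)
    {ι : Type*} [Fintype ι] {f : (ι → ℝ) → A →⋆ₙₐ[ℂ] G} (hf : ContinuousOn f (closedBall 0 1))
    (hfY : MapsTo f (closedBall 0 1) (supportedOn ρ π G (Q ∪ e '' closedBall 0 1)))
    (hfB : MapsTo f (sphere 0 1) (supportedOn ρ π G (Q ∪ e '' B))) :
    ∃ g, PairHomotopic (supportedOn ρ π G (Q ∪ e '' closedBall 0 1))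
        (supportedOn ρ π G (Q ∪ e '' B)) f g ∧
      ∀ B₁ B₂ : Set (Fin d → ℝ), B₁ ⊆ closedBall 0 1 → (∀ v ∈ B₁, s (1, v) ∈ B₂) →
        ∀ x ∈ closedBall (0 : ι → ℝ) 1, f x ∈ supportedOn ρ π G (Q ∪ e '' B₁) →
          g x ∈ supportedOn ρ π G (Q ∪ e '' B₂) := by
  classical
  have h0 : (0 : ℝ) ∈ Icc (0 : ℝ) 1 := ⟨le_rfl, zero_le_one⟩
  have h1 : (1 : ℝ) ∈ Icc (0 : ℝ) 1 := ⟨zero_le_one, le_rfl⟩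
  have hE : IsClosed (e '' closedBall 0 1) :=
    ((isCompact_closedBall _ _).image he).isClosed
  set Y := Q ∪ e '' closedBall 0 1 with hY
  have hYc : IsClosed Y := hQ.union hE
  set m : ℝ × K → K := fun p => if p.2 ∈ Q then p.2 else e (s (p.1, w p.2)) with hm
  have m_Q : ∀ t, ∀ y ∈ Q, m (t, y) = y := fun t y hy => if_pos hy
  have m_e : ∀ t ∈ Icc (0 : ℝ) 1, ∀ v ∈ closedBall (0 : Fin d → ℝ) 1,
      m (t, e v) = e (s (t, v)) := by
    intro t ht v hv
    by_cases h : e v ∈ Q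
    · rw [m_Q t _ h, hs_fix t ht v hv h]
    · simp only [hm, h, if_false, hwe v hv]
  have m_cont : ContinuousOn m (Icc 0 1 ×ˢ Y) := by
    rw [hY, prod_union]
    refine ContinuousOn.union_of_isClosed ?_ ?_ (isClosed_Icc.prod hQ) (isClosed_Icc.prod hE)
    · exact continuousOn_snd.congr fun p hp => m_Q p.1 p.2 hp.2
    · have : Continuous fun p : ℝ × K => e (s (p.1, w p.2)) := by fun_prop
      refine this.continuousOn.congr ?_
      rintro ⟨t, -⟩ ⟨ht, v, hv, rfl⟩
      dsimp only
      rw [m_e t ht v hv, hwe v hv]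
  have m_sub : ∀ t ∈ Icc (0 : ℝ) 1, ∀ B₁ B₂ : Set (Fin d → ℝ), B₁ ⊆ closedBall 0 1 →
      (∀ v ∈ B₁, s (t, v) ∈ B₂) → ∀ y ∈ Q ∪ e '' B₁, m (t, y) ∈ Q ∪ e '' B₂ := by
    rintro t ht B₁ B₂ hB₁ h y (hy | ⟨v, hv, rfl⟩)
    · rw [m_Q t y hy]; exact .inl hy
    · rw [m_e t ht v (hB₁ hv)]; exact .inr ⟨_, h v hv, rfl⟩
  obtain ⟨T, hTc, hTs, hTfix⟩ := exists_push (G := G) hA hYc (hPQ.trans subset_union_left) m_cont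
    fun t _ y hy => m_Q t y (hPQ hy)
  have sub : ∀ {B₁ : Set (Fin d → ℝ)}, B₁ ⊆ closedBall 0 1 → Q ∪ e '' B₁ ⊆ Y := fun h =>
    union_subset_union_right _ (image_mono h)
  refine ⟨fun x => T (1, f x), ⟨fun p => T (p.1, f p.2), ?_, ?_, fun _ _ => rfl, ?_, ?_⟩, ?_⟩
  · refine hTc.comp (continuousOn_fst.prodMk (hf.comp continuousOn_snd fun p hp => hp.2)) ?_
    exact fun p hp => ⟨hp.1, hfY hp.2⟩
  · intro x hx
    refine hTfix 0 h0 Y subset_rfl ?_ _ (hfY hx)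
    rintro y (hy | ⟨v, hv, rfl⟩)
    · exact m_Q 0 y hy
    · rw [m_e 0 h0 v hv, hs_zero v hv]
  · exact fun p hp => hTs p.1 hp.1 Y Y subset_rfl
      (m_sub p.1 hp.1 _ _ subset_rfl (hs_ball p.1 hp.1)) _ (hfY hp.2)
  · exact fun p hp => hTs p.1 hp.1 _ _ (sub hB) (m_sub p.1 hp.1 _ _ hB (hsB p.1 hp.1)) _ (hfB hp.2)
  · exact fun B₁ B₂ hB₁ h x _ hfx => hTs 1 h1 _ _ (sub hB₁) (m_sub 1 h1 _ _ hB₁ h) _ hfx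

/-- The set `Y` arises from the closed set `Y₀` by attaching a `d`-cell: `e` is the characteristic
map of the cell, defined on the cube `[-1, 1]^d`, `w` restricts to its inverse, and `N` is the norm
of the coordinates on the cell and equals `1` on `Y₀`. -/
structure IsCell {d : ℕ} (Y₀ Y : Set K) (e : (Fin d → ℝ) → K) (w : K → Fin d → ℝ)
    (N : K → ℝ) : Prop where
  isClosed : IsClosed Y₀
  continuous_map : Continuous e
  continuous_coord : Continuous w
  continuous_norm : Continuous N
  coord_map : ∀ v ∈ closedBall (0 : Fin d → ℝ) 1, w (e v) = v
  norm_map : ∀ v ∈ closedBall (0 : Fin d → ℝ) 1, N (e v) = ‖v‖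
  norm_base : ∀ y ∈ Y₀, N y = 1
  eq_union : Y = Y₀ ∪ e '' closedBall 0 1
  map_sphere : ∀ v ∈ sphere (0 : Fin d → ℝ) 1, e v ∈ Y₀

variable (ρ π P G) in
/-- Attaching a `d`-cell does not change the space of *-homomorphisms into `G` in dimensions
below `d`, up to homotopy. -/
def CellsCompressible (d : ℕ) : Prop :=
  ∀ (Y₀ Y : Set K) (e : (Fin d → ℝ) → K) (w : K → Fin d → ℝ) (N : K → ℝ), IsCell Y₀ Y e w N →
    P ⊆ Y₀ → ∀ (ι : Type) [Fintype ι], Fintype.card ι < d →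
      Compressible ι (supportedOn ρ π G Y) (supportedOn ρ π G Y₀)

end Cell

/-! ### Pushing supports off an isolated ball -/

section Ball

variable {A A₀ F G : Type*} [NonUnitalCStarAlgebra A] [NonUnitalCStarAlgebra A₀]
  [NonUnitalCStarAlgebra F] [NonUnitalCStarAlgebra G] [FiniteDimensional ℂ F]
  {K : Type*} [TopologicalSpace K] [T2Space K]
  {ρ : A →⋆ₙₐ[ℂ] C(K, F)} {π : A →⋆ₙₐ[ℂ] A₀} {P : Set K}

/-- The boundary of the cube without the open top face `v 0 = 1`. -/
def lowerSphere (d : ℕ) : Set (Fin (d + 1) → ℝ) :=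
  {v | ‖v‖ ≤ 1 ∧ (v 0 = -1 ∨ ‖Fin.tail v‖ = 1)}

theorem lowerSphere_subset_sphere (d : ℕ) : lowerSphere d ⊆ sphere 0 1 := by
  rintro v ⟨hv, h⟩
  rw [mem_sphere_iff_norm, sub_zero]
  refine le_antisymm hv ?_
  rw [norm_eq_max_head_tail]
  rcases h with h | h
  · exact le_max_of_le_left (by rw [h]; norm_num)
  · exact le_max_of_le_right h.ge

theorem continuous_tail {d : ℕ} : Continuous (Fin.tail : (Fin (d + 1) → ℝ) → Fin d → ℝ) :=
  continuous_pi fun i => continuous_apply i.succ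

theorem isCompact_lowerSphere (d : ℕ) : IsCompact (lowerSphere d) := by
  refine (isCompact_closedBall (0 : Fin (d + 1) → ℝ) 1).of_isClosed_subset ?_ fun v hv => by
    simpa using hv.1
  exact (isClosed_le continuous_norm continuous_const).inter
    ((isClosed_eq (continuous_apply 0) continuous_const).union
      (isClosed_eq continuous_tail.norm continuous_const))

theorem mem_lowerSphere_or_eq_cons {d : ℕ} {v : Fin (d + 1) → ℝ} (hv : ‖v‖ = 1) :
    v ∈ lowerSphere d ∨ ∃ z ∈ closedBall (0 : Fin d → ℝ) 1, v = Fin.cons 1 z := by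
  have h := norm_eq_max_head_tail v
  rw [hv] at h
  have ht : ‖Fin.tail v‖ ≤ 1 := h ▸ le_max_right _ _
  by_cases h1 : ‖Fin.tail v‖ = 1
  · exact .inl ⟨hv.le, .inr h1⟩
  · have h2 : ‖v 0‖ = 1 := by
      rcases max_choice ‖v 0‖ ‖Fin.tail v‖ with h' | h'
      · rw [← h', ← h]
      · exact absurd (h' ▸ h.symm) h1
    rw [Real.norm_eq_abs] at h2
    rcases eq_or_eq_neg_of_abs_eq h2 with h3 | h3
    · refine .inr ⟨Fin.tail v, by simpa using ht, ?_⟩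
      rw [← h3, Fin.cons_self_tail]
    · exact .inl ⟨hv.le, .inl h3⟩

/-- The boundary of an isolated ball arises from its lower part by attaching the top face. -/
theorem isCell_top_face {d : ℕ} {Q : Set K} (hQ : IsClosed Q)
    {e : (Fin (d + 1) → ℝ) → K} {w : K → Fin (d + 1) → ℝ} {M : K → ℝ} (he : Continuous e)
    (hw : Continuous w) (hM : Continuous M)
    (hwe : ∀ v ∈ closedBall (0 : Fin (d + 1) → ℝ) 1, w (e v) = v)
    (hMe : ∀ v ∈ closedBall (0 : Fin (d + 1) → ℝ) 1, M (e v) = 0) (hMQ : ∀ y ∈ Q, M y = 1) :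
    IsCell (Q ∪ e '' lowerSphere d) (Q ∪ e '' sphere 0 1) (fun z : Fin d → ℝ => e (Fin.cons 1 z))
      (fun y => Fin.tail (w y))
      (fun y => min 1 (‖Fin.tail (w y)‖ + |1 - w y 0| + |M y|)) := by
  have hcons : ∀ z ∈ closedBall (0 : Fin d → ℝ) 1,
      (Fin.cons 1 z : Fin (d + 1) → ℝ) ∈ closedBall 0 1 := by
    intro z hz
    rw [mem_closedBall, dist_zero_right] at hz ⊢
    rw [norm_cons]
    exact max_le (by norm_num) hz
  have low : ∀ v ∈ lowerSphere d, v ∈ closedBall (0 : Fin (d + 1) → ℝ) 1 := fun v hv =>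
    sphere_subset_closedBall (lowerSphere_subset_sphere d hv)
  refine ⟨hQ.union ((isCompact_lowerSphere d).image he).isClosed, ?_, continuous_tail.comp hw, ?_,
    ?_, ?_, ?_, ?_, ?_⟩
  · exact he.comp (Continuous.finCons continuous_const continuous_id)
  · have h0 : Continuous fun y => w y 0 := (continuous_apply 0).comp hw
    have h1 : Continuous fun y => ‖Fin.tail (w y)‖ := (continuous_tail.comp hw).norm
    fun_prop
  · intro z hz
    rw [hwe _ (hcons z hz), Fin.tail_cons]
  · intro z hz
    rw [hwe _ (hcons z hz), hMe _ (hcons z hz), Fin.tail_cons, Fin.cons_zero, sub_self, abs_zero,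
      add_zero, add_zero]
    exact min_eq_right (by simpa using hz)
  · rintro y (hy | ⟨v, hv, rfl⟩)
    · rw [hMQ y hy, abs_one]
      exact min_eq_left (by linarith [norm_nonneg (Fin.tail (w y)), abs_nonneg (1 - w y 0)])
    · rw [hwe v (low v hv), hMe v (low v hv), abs_zero, add_zero]
      refine min_eq_left ?_
      rcases hv.2 with h | h
      · rw [h]
        norm_num
        linarith [norm_nonneg (Fin.tail v)]
      · rw [h]
        linarith [abs_nonneg (1 - v 0)]
  · ext y
    constructor
    · rintro (hy | ⟨v, hv, rfl⟩)
      · exact .inl (.inl hy)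
      · rcases mem_lowerSphere_or_eq_cons (by simpa using hv) with h | ⟨z, hz, rfl⟩
        · exact .inl (.inr ⟨v, h, rfl⟩)
        · exact .inr ⟨z, hz, rfl⟩
    · rintro ((hy | ⟨v, hv, rfl⟩) | ⟨z, hz, rfl⟩)
      · exact .inl hy
      · exact .inr ⟨v, lowerSphere_subset_sphere d hv, rfl⟩
      · refine .inr ⟨Fin.cons 1 z, ?_, rfl⟩
        rw [mem_sphere_iff_norm, sub_zero, norm_cons]
        exact (max_eq_left (by simpa using hz)).trans norm_one
  · intro z hz
    refine .inr ⟨Fin.cons 1 z, ⟨?_, .inr ?_⟩, rfl⟩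
    · simpa using hcons z (sphere_subset_closedBall hz)
    · rw [Fin.tail_cons]; simpa using hz

/-- The deformation of the cube which pushes it down onto its bottom face. -/
noncomputable def pushDown {d : ℕ} (p : ℝ × (Fin (d + 1) → ℝ)) : Fin (d + 1) → ℝ :=
  Fin.cons ((1 - p.1) * p.2 0 - p.1) (Fin.tail p.2)

theorem continuous_pushDown {d : ℕ} :
    Continuous (pushDown : ℝ × (Fin (d + 1) → ℝ) → Fin (d + 1) → ℝ) := by
  unfold pushDown
  exact Continuous.finCons (by fun_prop) (continuous_tail.comp continuous_snd)

theorem pushDown_mem_closedBall {d : ℕ} {t : ℝ} (ht : t ∈ Icc (0 : ℝ) 1) {v : Fin (d + 1) → ℝ}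
    (hv : v ∈ closedBall 0 1) : pushDown (t, v) ∈ closedBall 0 1 := by
  rw [mem_closedBall, dist_zero_right] at hv ⊢
  rw [norm_eq_max_head_tail] at hv
  obtain ⟨h1, h2⟩ := max_le_iff.1 hv
  rw [pushDown, norm_cons]
  refine max_le ?_ h2
  have := abs_le.1 (Real.norm_eq_abs _ ▸ h1)
  rw [Real.norm_eq_abs, abs_le]
  constructor <;> nlinarith [ht.1, ht.2]

variable [CompactSpace K]

/-- An isolated ball of dimension `d + 1` in the support can be deformed off the centre, in
dimensions up to `d`. On the boundary of the cube the support is first stretched to the boundary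
of the ball and then moved off the top face, which is a cell of dimension `d`; after that the whole
ball can be pushed down onto its bottom face. -/
theorem compressible_isolated_ball (hA : IsRelativeTo ρ π P) {d : ℕ}
    (ih : CellsCompressible G ρ π P d) {Q : Set K} (hQ : IsClosed Q) (hPQ : P ⊆ Q)
    {e : (Fin (d + 1) → ℝ) → K} {w : K → Fin (d + 1) → ℝ} {M : K → ℝ} (he : Continuous e)
    (hw : Continuous w) (hM : Continuous M)
    (hwe : ∀ v ∈ closedBall (0 : Fin (d + 1) → ℝ) 1, w (e v) = v)
    (hMe : ∀ v ∈ closedBall (0 : Fin (d + 1) → ℝ) 1, M (e v) = 0) (hMQ : ∀ y ∈ Q, M y = 1)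
    {ε : ℝ} (hε : 0 < ε) (hε1 : ε ≤ 1) (ι : Type) [Fintype ι] (hι : Fintype.card ι < d + 1) :
    Compressible ι (supportedOn ρ π G (Q ∪ e '' closedBall 0 1))
      (supportedOn ρ π G (Q ∪ e '' {v | ε ≤ ‖v‖ ∧ ‖v‖ ≤ 1})) := by
  classical
  have eQ : ∀ v ∈ closedBall (0 : Fin (d + 1) → ℝ) 1, e v ∉ Q := fun v hv h => by
    have h1 := hMQ _ h
    rw [hMe v hv] at h1
    exact zero_ne_one h1
  have sph_ann : (sphere 0 1 : Set (Fin (d + 1) → ℝ)) ⊆ {v | ε ≤ ‖v‖ ∧ ‖v‖ ≤ 1} := fun v hv => by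
    have hv' : ‖v‖ = 1 := by simpa using hv
    exact ⟨by rw [hv']; exact hε1, hv'.le⟩
  have supp_mono : ∀ {B₁ B₂ : Set (Fin (d + 1) → ℝ)}, B₁ ⊆ B₂ →
      supportedOn ρ π G (Q ∪ e '' B₁) ⊆ supportedOn ρ π G (Q ∪ e '' B₂) := fun h =>
    supportedOn_mono (union_subset_union_right _ (image_mono h))
  have low_ball : lowerSphere d ⊆ closedBall 0 1 :=
    (lowerSphere_subset_sphere d).trans sphere_subset_closedBall
  have h1 : (1 : ℝ) ∈ Icc (0 : ℝ) 1 := ⟨zero_le_one, le_rfl⟩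
  intro f hf hfY hfS
  -- stretching moves the support over the boundary of the cube to the boundary of the ball
  obtain ⟨g₁, hg₁, hg₁s⟩ := exists_pairHomotopic_push hA hQ hPQ he hw hwe
    (s := stretch ε) (continuous_stretch hε)
    (fun t ht v hv => by
      rw [mem_closedBall, dist_zero_right] at hv ⊢; exact norm_stretch_le hε ht hv)
    (fun t ht v hv h => absurd h (eQ v hv)) (fun v _ => stretch_zero v)
    (B := {v | ε ≤ ‖v‖ ∧ ‖v‖ ≤ 1}) (fun v hv => by simpa using hv.2)
    (fun t ht v hv => ⟨hv.1.trans (le_norm_stretch hε hε1 ht hv.2), norm_stretch_le hε ht hv.2⟩)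
    hf hfY hfS
  have hg₁S : MapsTo g₁ (sphere 0 1) (supportedOn ρ π G (Q ∪ e '' sphere 0 1)) := fun x hx =>
    hg₁s _ _ (fun v hv => by simpa using hv.2)
      (fun v hv => by rw [mem_sphere_iff_norm, sub_zero]; exact norm_stretch_one hε hv.1) x
      (sphere_subset_closedBall hx) (hfS hx)
  -- over the boundary of the cube the support is moved off the top face, cell by cell
  set W : Set (ι → ℝ) → Set (A →⋆ₙₐ[ℂ] G) := fun C =>
    if C ⊆ sphere 0 1 then supportedOn ρ π G (Q ∪ e '' sphere 0 1)
    else supportedOn ρ π G (Q ∪ e '' closedBall 0 1) with hW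
  set T : Set (ι → ℝ) → Set (A →⋆ₙₐ[ℂ] G) := fun C =>
    if C ⊆ sphere 0 1 then supportedOn ρ π G (Q ∪ e '' lowerSphere d)
    else supportedOn ρ π G (Q ∪ e '' closedBall 0 1) with hT
  have W_le : ∀ C, W C ⊆ supportedOn ρ π G (Q ∪ e '' closedBall 0 1) := fun C => by
    simp only [hW]
    split_ifs
    · exact supp_mono sphere_subset_closedBall
    · exact subset_rfl
  have T_le : ∀ C, T C ⊆ supportedOn ρ π G (Q ∪ e '' closedBall 0 1) := fun C => by
    simp only [hT]
    split_ifs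
    · exact supp_mono low_ball
    · exact subset_rfl
  have Wm : Monotone W := fun C C' h => by
    by_cases h' : C' ⊆ sphere 0 1
    · simp only [hW, h', h.trans h', if_true]; exact subset_rfl
    · have : W C' = supportedOn ρ π G (Q ∪ e '' closedBall 0 1) := if_neg h'
      rw [this]; exact W_le C
  have Tm : Monotone T := fun C C' h => by
    by_cases h' : C' ⊆ sphere 0 1
    · simp only [hT, h', h.trans h', if_true]; exact subset_rfl
    · have : T C' = supportedOn ρ π G (Q ∪ e '' closedBall 0 1) := if_neg h'
      rw [this]; exact T_le C
  have fill : ∀ (a : ι → ℤ) (s : Finset ι), gridCell a s ⊆ closedBall 0 ((1 : ℕ) : ℝ) →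
      Fillable s (W (gridCell a s)) (T (gridCell a s)) := by
    intro a s _
    by_cases h : gridCell a s ⊆ sphere 0 1
    · simp only [hW, hT, h, if_true]
      refine Compressible.fillable (ih _ _ _ _ _
        (isCell_top_face hQ he hw hM hwe hMe hMQ) (hPQ.trans subset_union_left) s ?_)
      have := card_lt_of_gridCell_subset_sphere h
      rw [Fintype.card_coe]
      omega
    · simp only [hW, hT, h, if_false]
      exact (Compressible.refl _).fillable
  have start : ∀ (a : ι → ℤ) (s : Finset ι), gridCell a s ⊆ closedBall 0 ((1 : ℕ) : ℝ) →
      MapsTo g₁ (gridCell a s) (W (gridCell a s)) := by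
    intro a s has x hx
    by_cases h : gridCell a s ⊆ sphere 0 1
    · simp only [hW, h, if_true]
      exact hg₁S (h hx)
    · simp only [hW, h, if_false]
      exact hg₁.mapsTo_right (by simpa using has hx)
  obtain ⟨H, Hc, H0, Hs⟩ := exists_homotopy_of_gridCell 1 Wm Tm fill
    (by simpa using hg₁.continuousOn_right) start
  rw [Nat.cast_one] at Hc H0
  have cellsub : ∀ x ∈ closedBall (0 : ι → ℝ) 1,
      gridCell (fun i => ⌊x i⌋) (activeDir x) ⊆ closedBall 0 ((1 : ℕ) : ℝ) := fun x hx =>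
    gridCell_floor_subset_closedBall (by simpa using hx)
  have sphsub : ∀ x ∈ sphere (0 : ι → ℝ) 1,
      gridCell (fun i => ⌊x i⌋) (activeDir x) ⊆ sphere 0 1 := fun x hx => by
    simpa using gridCell_floor_subset_sphere one_pos (by simpa using hx)
  set g₂ : (ι → ℝ) → A →⋆ₙₐ[ℂ] G := fun x => H (1, x) with hg₂
  have hg₁₂ : PairHomotopic (supportedOn ρ π G (Q ∪ e '' closedBall 0 1))
      (supportedOn ρ π G (Q ∪ e '' {v | ε ≤ ‖v‖ ∧ ‖v‖ ≤ 1})) g₁ g₂ := by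
    refine ⟨H, Hc, H0, fun _ _ => rfl, ?_, ?_⟩
    · rintro ⟨t, x⟩ ⟨ht, hx⟩
      exact W_le _ ((Hs _ _ (cellsub x hx)).1 ⟨ht, mem_gridCell_floor x⟩)
    · rintro ⟨t, x⟩ ⟨ht, hx⟩
      have := (Hs _ _ (cellsub x (sphere_subset_closedBall hx))).1 ⟨ht, mem_gridCell_floor x⟩
      simp only [hW, sphsub x hx, if_true] at this
      exact supp_mono sph_ann this
  have hg₂S : MapsTo g₂ (sphere 0 1) (supportedOn ρ π G (Q ∪ e '' lowerSphere d)) := by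
    intro x hx
    have := (Hs _ _ (cellsub x (sphere_subset_closedBall hx))).2 x (mem_gridCell_floor x)
    simp only [hT, sphsub x hx, if_true] at this
    exact this
  -- pushing the ball down onto its bottom face
  obtain ⟨g₃, hg₃, hg₃s⟩ := exists_pairHomotopic_push hA hQ hPQ he hw hwe
    (s := pushDown) continuous_pushDown (fun t ht v hv => pushDown_mem_closedBall ht hv)
    (fun t ht v hv h => absurd h (eQ v hv)) (fun v _ => by simp [pushDown])
    (B := lowerSphere d) low_ball
    (fun t ht v hv => by
      refine ⟨by simpa using pushDown_mem_closedBall ht (low_ball hv), ?_⟩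
      refine hv.2.imp (fun h => ?_) fun h => ?_
      · rw [pushDown, Fin.cons_zero]; dsimp only; rw [h]; ring
      · rwa [pushDown, Fin.tail_cons])
    hg₁₂.continuousOn_right hg₁₂.mapsTo_right hg₂S
  have low_ann : lowerSphere d ⊆ {v | ε ≤ ‖v‖ ∧ ‖v‖ ≤ 1} :=
    (lowerSphere_subset_sphere d).trans sph_ann
  refine ⟨g₃, (hg₁.trans hg₁₂).trans (hg₃.mono (supp_mono low_ann)), fun x hx => ?_⟩
  refine supp_mono low_ann (hg₃s (closedBall 0 1) (lowerSphere d) subset_rfl (fun v hv => ?_) x hx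
    (hg₁₂.mapsTo_right hx))
  refine ⟨by simpa using pushDown_mem_closedBall h1 hv, .inl ?_⟩
  rw [pushDown, Fin.cons_zero]; ring

end Ball

/-! ### Spherical shells which miss the support -/

section Shells

open scoped CStarAlgebra

variable {A A₀ F G : Type*} [NonUnitalCStarAlgebra A] [NonUnitalCStarAlgebra A₀]
  [NonUnitalCStarAlgebra F] [NonUnitalCStarAlgebra G]
  {K : Type*} [TopologicalSpace K] {ρ : A →⋆ₙₐ[ℂ] C(K, F)} {π : A →⋆ₙₐ[ℂ] A₀} {P Y : Set K}

theorem exists_bump [FiniteDimensional ℂ F] (hA : IsRelativeTo ρ π P) {β : K → ℝ}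
    (hβ : Continuous β) (hβP : ∀ y ∈ P, β y = 0) :
    ∃ b : A, π b = 0 ∧ star (ρ b) = ρ b ∧ ∀ a y, ρ (b * a) y = (β y : ℂ) • ρ a y := by
  obtain ⟨e, he, hes⟩ := exists_one_of_finiteDimensional F
  obtain ⟨b, hb, hb'⟩ := hA 0 ⟨fun y => (β y : ℂ) • e, by fun_prop⟩ fun y hy => by
    rw [map_zero]
    simp [hβP y hy]
  refine ⟨b, by rw [hb', map_zero], ?_, fun a y => ?_⟩
  · ext y
    rw [hb]
    simp [hes]
  · rw [map_mul, hb]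
    change ((β y : ℂ) • e) * ρ a y = _
    rw [smul_mul_assoc, he]

/-- Among more than `dim G` orthogonal self-adjoint elements, one has norm less than `1` under a
given *-homomorphism into `G`. -/
theorem exists_norm_lt_one [FiniteDimensional ℂ G] {n : ℕ} (hn : Module.finrank ℂ G < n)
    (φ : A →⋆ₙₐ[ℂ] G) {b : Fin n → A} (hs : ∀ j, star (φ (b j)) = φ (b j))
    (ho : ∀ i j, i ≠ j → φ (b i) * φ (b j) = 0) : ∃ j, ‖φ (b j)‖ < 1 := by
  by_contra! h
  have hne : ∀ j, φ (b j) * φ (b j) ≠ 0 := fun j h0 => by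
    have h1 : ‖star (φ (b j)) * φ (b j)‖ = ‖φ (b j)‖ * ‖φ (b j)‖ := CStarRing.norm_star_mul_self
    rw [hs, h0, norm_zero] at h1
    nlinarith [h j]
  have hli : LinearIndependent ℂ fun j => φ (b j) := by
    rw [Fintype.linearIndependent_iff]
    intro c hc i
    have h1 : φ (b i) * ∑ j, c j • φ (b j) = c i • (φ (b i) * φ (b i)) := by
      rw [Finset.mul_sum, Finset.sum_eq_single i]
      · rw [mul_smul_comm]
      · intro j _ hj
        rw [mul_smul_comm, ho i j hj.symm, smul_zero]
      · simp
    rw [hc, mul_zero] at h1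
    exact (smul_eq_zero.1 h1.symm).resolve_right (hne i)
  have := hli.fintype_card_le_finrank
  rw [Fintype.card_fin] at this
  omega

/-- If the bump functions equal to `1` on certain shells have norm less than `1` under a
*-homomorphism, then its support misses these shells. -/
theorem mem_supportedOn_diff {n : ℕ} {β : Fin n → K → ℝ} {S : Fin n → Set K}
    (hβ1 : ∀ j, ∀ y ∈ S j, β j y = 1) (hβ0 : ∀ i j, i ≠ j → ∀ y ∈ S i, β j y = 0)
    {b : Fin n → A}
    (hb : ∀ j a y, ρ (b j * a) y = (β j y : ℂ) • ρ a y)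
    {φ : A →⋆ₙₐ[ℂ] G} (hφ : φ ∈ supportedOn ρ π G Y) {R : Finset (Fin n)}
    (hR : ∀ j ∈ R, ‖φ (b j)‖ < 1) : φ ∈ supportedOn ρ π G (Y \ ⋃ j ∈ R, S j) := by
  intro a ha haY
  have cases : ∀ y ∈ Y, ρ a y = 0 ∨ ∃ i ∈ R, y ∈ S i := by
    intro y hy
    by_cases h : ∃ i ∈ R, y ∈ S i
    · exact .inr h
    · exact .inl (haY y ⟨hy, fun h' => h (by simpa using h')⟩)
  have kill : ∀ j ∈ R, φ (b j * a) = 0 := by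
    intro j hj
    have h1 : φ (b j * (b j * a)) = φ (b j * a) := by
      refine eq_of_mem_supportedOn hφ (by simp [ha]) fun y hy => ?_
      rw [hb, hb]
      rcases cases y hy with h | ⟨i, -, hi⟩
      · simp [h]
      · by_cases hij : i = j
        · subst hij; simp [hβ1 i y hi]
        · simp [hβ0 i j hij y hi]
    have h2 : ‖φ (b j * a)‖ ≤ ‖φ (b j)‖ * ‖φ (b j * a)‖ := by
      conv_lhs => rw [← h1, map_mul]
      exact norm_mul_le _ _
    have h3 : ‖φ (b j * a)‖ = 0 := by
      nlinarith [hR j hj, norm_nonneg (φ (b j * a))]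
    exact norm_eq_zero.1 h3
  have h4 : φ a = φ (∑ j ∈ R, b j * a) := by
    refine eq_of_mem_supportedOn hφ (by simp [ha]) fun y hy => ?_
    rw [map_sum, ContinuousMap.coe_sum, Finset.sum_apply]
    simp only [hb]
    rcases cases y hy with h | ⟨i, hiR, hi⟩
    · simp [h]
    · rw [Finset.sum_eq_single i]
      · simp [hβ1 i y hi]
      · intro j _ hj
        simp [hβ0 i j hj.symm y hi]
      · exact fun h => absurd hiR h
  rw [h4, map_sum]
  exact Finset.sum_eq_zero kill

/-- The bump function on the real line which is `1` on `[2 j + 1, 2 j + 2]` and vanishes at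
distance `1 / 2` from this interval. -/
noncomputable def shellBump (j : ℕ) (x : ℝ) : ℝ := max 0 (min 1 (2 - 2 * |x - (2 * j + 3 / 2)|))

theorem continuous_shellBump (j : ℕ) : Continuous (shellBump j) := by
  unfold shellBump; fun_prop

theorem shellBump_eq_one {j : ℕ} {x : ℝ} (h1 : 2 * j + 1 ≤ x) (h2 : x ≤ 2 * j + 2) :
    shellBump j x = 1 := by
  have : |x - (2 * j + 3 / 2)| ≤ 1 / 2 := abs_le.2 ⟨by linarith, by linarith⟩
  rw [shellBump, min_eq_left (by linarith), max_eq_right zero_le_one]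

theorem shellBump_eq_zero {j : ℕ} {x : ℝ} (h : 1 ≤ |x - (2 * j + 3 / 2)|) : shellBump j x = 0 :=
  max_eq_left ((min_le_right _ _).trans (by linarith))

theorem shellBump_mul_eq_zero {i j : ℕ} (hij : i ≠ j) (x : ℝ) :
    shellBump i x * shellBump j x = 0 := by
  by_contra h
  have h1 : |x - (2 * i + 3 / 2)| < 1 := by
    by_contra! h'
    exact h (by rw [shellBump_eq_zero h', zero_mul])
  have h2 : |x - (2 * j + 3 / 2)| < 1 := by
    by_contra! h'
    exact h (by rw [shellBump_eq_zero h', mul_zero])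
  rw [abs_lt] at h1 h2
  have h3 : (i : ℝ) < j + 1 := by linarith
  have h4 : (j : ℝ) < i + 1 := by linarith
  have h3' : i < j + 1 := by exact_mod_cast h3
  have h4' : j < i + 1 := by exact_mod_cast h4
  omega

end Shells

/-! ### Pushing supports off a cell -/

section Core

open scoped CStarAlgebra

variable {A A₀ F G : Type*} [NonUnitalCStarAlgebra A] [NonUnitalCStarAlgebra A₀]
  [NonUnitalCStarAlgebra F] [NonUnitalCStarAlgebra G] [FiniteDimensional ℂ F]
  {K : Type*} [TopologicalSpace K] [CompactSpace K] [T2Space K]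
  {ρ : A →⋆ₙₐ[ℂ] C(K, F)} {π : A →⋆ₙₐ[ℂ] A₀} {P : Set K}

/-- A finite cover of a cube by sets open in it is refined by a fine enough grid. -/
theorem exists_grid_refinement {ι : Type*} [Fintype ι] {n : ℕ} {m : Fin n → (ι → ℝ) → ℝ}
    (hm : ∀ j, ContinuousOn (m j) (closedBall 0 1))
    (hcov : ∀ x ∈ closedBall (0 : ι → ℝ) 1, ∃ j, m j x < 1) :
    ∃ L : ℕ, 0 < L ∧ ∀ (a : ι → ℤ) (s : Finset ι), gridCell a s ⊆ closedBall 0 (L : ℝ) →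
      ∃ j, ∀ x ∈ gridCell a s, m j ((L : ℝ)⁻¹ • x) < 1 := by
  have hopen : ∀ j, ∃ u : Set (ι → ℝ), IsOpen u ∧
      m j ⁻¹' Iio 1 ∩ closedBall 0 1 = u ∩ closedBall 0 1 := fun j =>
    continuousOn_iff'.1 (hm j) _ isOpen_Iio
  choose c hc hcm using hopen
  obtain ⟨δ, hδ, hδc⟩ := lebesgue_number_lemma_of_metric
    (isCompact_closedBall (0 : ι → ℝ) 1) hc fun x hx => by
      obtain ⟨j, hj⟩ := hcov x hx
      exact mem_iUnion.2 ⟨j, ((hcm j).subset ⟨hj, hx⟩).1⟩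
  obtain ⟨k, hk⟩ := exists_nat_one_div_lt hδ
  have hpos : (0 : ℝ) < ((k + 1 : ℕ) : ℝ) := by positivity
  have scale : ∀ x ∈ closedBall (0 : ι → ℝ) ((k + 1 : ℕ) : ℝ),
      (((k + 1 : ℕ) : ℝ)⁻¹ • x) ∈ closedBall (0 : ι → ℝ) 1 := by
    intro x hx
    rw [mem_closedBall, dist_zero_right] at hx ⊢
    rw [norm_smul, norm_inv, Real.norm_of_nonneg hpos.le, inv_mul_le_iff₀ hpos, mul_one]
    exact hx
  refine ⟨k + 1, Nat.succ_pos k, fun a s has => ?_⟩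
  obtain ⟨j, hj⟩ := hδc _ (scale _ (has (corner_mem_gridCell a s)))
  refine ⟨j, fun x hx => ?_⟩
  refine ((hcm j).superset ⟨hj ?_, scale x (has hx)⟩).1
  rw [mem_ball, dist_eq_norm, ← smul_sub, norm_smul, norm_inv, Real.norm_of_nonneg hpos.le]
  calc ((k + 1 : ℕ) : ℝ)⁻¹ * _ ≤ ((k + 1 : ℕ) : ℝ)⁻¹ * 1 := by
        gcongr; exact norm_sub_le_of_mem_gridCell hx (corner_mem_gridCell a s)
    _ < δ := by rw [mul_one]; push_cast; rwa [← one_div]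

/-- The compression away from a nonempty set of shells: once the innermost of these shells is
removed from the cell, the rest inside is an isolated ball. -/
theorem compressible_diff_shells (hA : IsRelativeTo ρ π P) {d : ℕ}
    (ih : CellsCompressible G ρ π P d) {Y₀ Y : Set K} {e : (Fin (d + 1) → ℝ) → K}
    {w : K → Fin (d + 1) → ℝ} {N : K → ℝ} (hc : IsCell Y₀ Y e w N) (hP : P ⊆ Y₀) {n : ℕ}
    {R : Finset (Fin n)} (hR : R.Nonempty) (ι : Type) [Fintype ι] (hι : Fintype.card ι < d + 1) :
    Compressible ι
      (supportedOn ρ π G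
        (Y \ ⋃ j ∈ R, {y | 2 * (j : ℕ) + 1 < (2 * n + 2) * N y ∧ (2 * n + 2) * N y < 2 * (j : ℕ) + 2}))
      (supportedOn ρ π G
        ((Y \ ⋃ j ∈ R, {y | 2 * (j : ℕ) + 1 < (2 * n + 2) * N y ∧ (2 * n + 2) * N y < 2 * (j : ℕ) + 2})
          ∩ {y | 1 ≤ (2 * n + 2) * N y})) := by
  set S : Fin n → Set K := fun j =>
    {y | 2 * (j : ℕ) + 1 < (2 * n + 2) * N y ∧ (2 * n + 2) * N y < 2 * (j : ℕ) + 2} with hS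
  set j₀ := R.min' hR with hj₀
  have hj₀R : j₀ ∈ R := R.min'_mem hR
  have hj₀n : (j₀ : ℕ) < n := j₀.2
  have hj₀n' : ((j₀ : ℕ) : ℝ) + 1 ≤ n := by exact_mod_cast hj₀n
  have hn : (0 : ℝ) < 2 * n + 2 := by positivity
  set r : ℝ := (2 * (j₀ : ℕ) + 1) / (2 * n + 2) with hr
  have hr0 : 0 < r := by positivity
  have hr1 : r ≤ 1 := by rw [hr, div_le_one hn]; linarith
  have hnr : (2 * n + 2) * r = 2 * (j₀ : ℕ) + 1 := by rw [hr]; field_simp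
  have Yc : IsClosed Y := by
    rw [hc.eq_union]
    exact hc.isClosed.union ((isCompact_closedBall _ _).image hc.continuous_map).isClosed
  have So : ∀ j, IsOpen (S j) := fun j =>
    (isOpen_lt continuous_const (continuous_const.mul hc.continuous_norm)).inter
      (isOpen_lt (continuous_const.mul hc.continuous_norm) continuous_const)
  set Z : Set K := Y \ ⋃ j ∈ R, S j with hZ
  have Zc : IsClosed Z := Yc.sdiff (isOpen_biUnion fun j _ => So j)
  have Y₀Z : Y₀ ⊆ Z := by
    intro y hy
    refine ⟨by rw [hc.eq_union]; exact .inl hy, ?_⟩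
    simp only [mem_iUnion, not_exists]
    rintro j - ⟨-, h⟩
    rw [hc.norm_base y hy] at h
    have : ((j : ℕ) : ℝ) + 1 ≤ n := by exact_mod_cast j.2
    linarith
  set Q : Set K := Z ∩ {y | 2 * (j₀ : ℕ) + 2 ≤ (2 * n + 2) * N y} with hQ
  have Qc : IsClosed Q :=
    Zc.inter (isClosed_le continuous_const (continuous_const.mul hc.continuous_norm))
  have hPQ : P ⊆ Q := fun y hy => ⟨Y₀Z (hP hy), by
    rw [mem_ofPred_eq, hc.norm_base y (hP hy)]; linarith⟩
  have rball : ∀ v ∈ closedBall (0 : Fin (d + 1) → ℝ) 1,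
      r • v ∈ closedBall (0 : Fin (d + 1) → ℝ) 1 ∧ N (e (r • v)) = r * ‖v‖ := by
    intro v hv
    have hv' : ‖v‖ ≤ 1 := by simpa using hv
    have h1 : ‖r • v‖ = r * ‖v‖ := by rw [norm_smul, Real.norm_of_nonneg hr0.le]
    have h2 : r • v ∈ closedBall (0 : Fin (d + 1) → ℝ) 1 := by
      rw [mem_closedBall, dist_zero_right, h1]
      nlinarith [norm_nonneg v]
    exact ⟨h2, by rw [hc.norm_map _ h2, h1]⟩
  have er_Z : ∀ v ∈ closedBall (0 : Fin (d + 1) → ℝ) 1, e (r • v) ∈ Z := by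
    intro v hv
    obtain ⟨h1, h2⟩ := rball v hv
    have hv' : ‖v‖ ≤ 1 := by simpa using hv
    refine ⟨by rw [hc.eq_union]; exact .inr ⟨_, h1, rfl⟩, ?_⟩
    simp only [mem_iUnion, not_exists]
    rintro j hj ⟨h, -⟩
    have h3 : ((j₀ : ℕ) : ℝ) ≤ (j : ℕ) := by exact_mod_cast R.min'_le j hj
    rw [h2, ← mul_assoc, hnr] at h
    nlinarith [norm_nonneg v]
  have split : ∀ y ∈ Z, y ∈ Q ∨ ∃ v, ‖v‖ ≤ 1 ∧ e (r • v) = y ∧ N y = r * ‖v‖ := by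
    rintro y ⟨hyY, hyS⟩
    by_cases h : 2 * (j₀ : ℕ) + 2 ≤ (2 * n + 2) * N y
    · exact .inl ⟨⟨hyY, hyS⟩, h⟩
    · refine .inr ?_
      have h1 : (2 * n + 2) * N y ≤ 2 * (j₀ : ℕ) + 1 := by
        by_contra! h'
        exact hyS (mem_biUnion hj₀R ⟨h', not_le.1 h⟩)
      rw [hc.eq_union] at hyY
      rcases hyY with hy | ⟨v, hv, rfl⟩
      · rw [hc.norm_base y hy] at h1
        linarith
      · rw [hc.norm_map v hv, ← hnr] at h1
        have h2 : ‖v‖ ≤ r := le_of_mul_le_mul_left h1 hn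
        refine ⟨r⁻¹ • v, ?_, ?_, ?_⟩
        · rw [norm_smul, norm_inv, Real.norm_of_nonneg hr0.le, inv_mul_le_iff₀ hr0, mul_one]
          exact h2
        · rw [smul_smul, mul_inv_cancel₀ hr0.ne', one_smul]
        · rw [hc.norm_map v hv, norm_smul, norm_inv, Real.norm_of_nonneg hr0.le,
            mul_inv_cancel_left₀ hr0.ne']
  set ε : ℝ := 1 / (2 * (j₀ : ℕ) + 1) with hε
  have hεp : (0 : ℝ) < 2 * (j₀ : ℕ) + 1 := by positivity
  have hN_ann : ∀ v : Fin (d + 1) → ℝ, 1 ≤ (2 * n + 2) * (r * ‖v‖) ↔ ε ≤ ‖v‖ := by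
    intro v
    rw [← mul_assoc, hnr, hε, div_le_iff₀ hεp, mul_comm]
  have eqZ : Z = Q ∪ (fun v => e (r • v)) '' closedBall 0 1 := by
    ext y
    constructor
    · intro hy
      rcases split y hy with h | ⟨v, hv, rfl, -⟩
      · exact .inl h
      · exact .inr ⟨v, by simpa using hv, rfl⟩
    · rintro (h | ⟨v, hv, rfl⟩)
      · exact h.1
      · exact er_Z v hv
  have eqZ' : Z ∩ {y | 1 ≤ (2 * n + 2) * N y} =
      Q ∪ (fun v => e (r • v)) '' {v | ε ≤ ‖v‖ ∧ ‖v‖ ≤ 1} := by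
    ext y
    constructor
    · rintro ⟨hy, h1⟩
      rcases split y hy with h | ⟨v, hv, rfl, h2⟩
      · exact .inl h
      · rw [mem_ofPred_eq, h2, hN_ann] at h1
        exact .inr ⟨v, ⟨h1, hv⟩, rfl⟩
    · rintro (h | ⟨v, ⟨hv, hv'⟩, rfl⟩)
      · refine ⟨h.1, ?_⟩
        have h2 := h.2
        rw [mem_ofPred_eq] at h2 ⊢
        have : (0 : ℝ) ≤ (j₀ : ℕ) := Nat.cast_nonneg _
        linarith
      · have hvb : v ∈ closedBall (0 : Fin (d + 1) → ℝ) 1 := by simpa using hv'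
        refine ⟨er_Z v hvb, ?_⟩
        rw [mem_ofPred_eq, (rball v hvb).2, hN_ann]
        exact hv
  rw [eqZ', eqZ]
  refine compressible_isolated_ball hA ih Qc hPQ (e := fun v => e (r • v))
    (w := fun y => r⁻¹ • w y)
    (M := fun y => max 0 (min 1 ((2 * n + 2) * N y - (2 * (j₀ : ℕ) + 1))))
    (hc.continuous_map.comp (continuous_const_smul r))
    ((continuous_const_smul r⁻¹).comp hc.continuous_coord) ?_ ?_ ?_
    ?_ (by positivity) ?_ ι hι
  · have := hc.continuous_norm
    fun_prop
  · intro v hv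
    rw [hc.coord_map _ (rball v hv).1, smul_smul, inv_mul_cancel₀ hr0.ne', one_smul]
  · intro v hv
    have hv' : ‖v‖ ≤ 1 := by simpa using hv
    refine max_eq_left ((min_le_right _ _).trans ?_)
    rw [(rball v hv).2, ← mul_assoc, hnr]
    nlinarith
  · intro y hy
    have h2 := hy.2
    rw [mem_ofPred_eq] at h2
    rw [min_eq_left (by linarith), max_eq_right zero_le_one]
  · rw [hε, div_le_one hεp]
    have : (0 : ℝ) ≤ (j₀ : ℕ) := Nat.cast_nonneg _
    linarith

variable [FiniteDimensional ℂ G]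

/-- The inductive step. For a *-homomorphism into `G`, one of `dim G + 1` shells around the centre
of the cell misses the support. In a fine grid on the cube, each grid cell has such a shell in
common for all its points, and the compressions inside the shells fit together. -/
theorem CellsCompressible.succ (hA : IsRelativeTo ρ π P) {d : ℕ}
    (ih : CellsCompressible G ρ π P d) : CellsCompressible G ρ π P (d + 1) := by
  classical
  intro Y₀ Y e w N hc hP ι _ hι f hf hfY hfS
  obtain ⟨n, hn⟩ : ∃ n, n = Module.finrank ℂ G + 1 := ⟨_, rfl⟩
  have hn0 : (0 : ℝ) < 2 * n + 2 := by positivity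
  have Y₀Y : Y₀ ⊆ Y := by rw [hc.eq_union]; exact subset_union_left
  set S : Fin n → Set K := fun j =>
    {y | 2 * (j : ℕ) + 1 < (2 * n + 2) * N y ∧ (2 * n + 2) * N y < 2 * (j : ℕ) + 2} with hS
  set β : Fin n → K → ℝ := fun j y => shellBump j ((2 * n + 2) * N y) with hβ
  have β1 : ∀ j, ∀ y ∈ S j, β j y = 1 := fun j y hy => shellBump_eq_one hy.1.le hy.2.le
  have ββ : ∀ i j, i ≠ j → ∀ y, β i y * β j y = 0 := fun i j hij y =>
    shellBump_mul_eq_zero (fun h => hij (Fin.ext h)) _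
  have β0 : ∀ i j, i ≠ j → ∀ y ∈ S i, β j y = 0 := fun i j hij y hy => by
    simpa [β1 i y hy] using ββ i j hij y
  have βP : ∀ j, ∀ y ∈ P, β j y = 0 := by
    intro j y hy
    have : ((j : ℕ) : ℝ) + 1 ≤ n := by exact_mod_cast j.2
    refine shellBump_eq_zero (le_trans ?_ (le_abs_self _))
    rw [hc.norm_base y (hP hy)]
    linarith
  have hb : ∀ j, ∃ b : A, π b = 0 ∧ star (ρ b) = ρ b ∧
      ∀ a y, ρ (b * a) y = (β j y : ℂ) • ρ a y := fun j =>
    exists_bump hA ((continuous_shellBump j).comp (continuous_const.mul hc.continuous_norm)) (βP j)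
  choose b hb0 hbs hb using hb
  have cover : ∀ φ ∈ supportedOn ρ π G Y, ∃ j, ‖φ (b j)‖ < 1 := by
    intro φ hφ
    refine exists_norm_lt_one (by omega) φ (fun j => ?_) fun i j hij => ?_
    · rw [← map_star]
      refine eq_of_mem_supportedOn hφ (by rw [map_star, hb0, star_zero]) fun y _ => ?_
      rw [map_star, hbs]
    · rw [← map_mul]
      refine hφ _ (by simp [hb0]) fun y _ => ?_
      -- the product of two bumps vanishes, as one sees after multiplying it by itself
      have h1 : ρ (b i * (b j * star (b i * b j))) y = 0 := by
        rw [hb, hb, smul_smul, ← Complex.ofReal_mul, ββ i j hij, Complex.ofReal_zero, zero_smul]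
      have h2 : ρ (b i * b j) y * star (ρ (b i * b j) y) = 0 := by
        rw [← mul_assoc, map_mul, map_star] at h1
        exact h1
      exact CStarRing.mul_star_self_eq_zero_iff _ |>.1 h2
  obtain ⟨L, hL, hLc⟩ := exists_grid_refinement (m := fun j x => ‖f x (b j)‖)
    (fun j => ((continuousOn_hom_iff.1 hf) (b j)).norm) fun x hx => cover _ (hfY hx)
  have hLpos : (0 : ℝ) < L := by exact_mod_cast hL
  have down : ∀ x ∈ closedBall (0 : ι → ℝ) L, (L : ℝ)⁻¹ • x ∈ closedBall (0 : ι → ℝ) 1 := by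
    intro x hx
    rw [mem_closedBall, dist_zero_right] at hx ⊢
    rw [norm_smul, norm_inv, Real.norm_of_nonneg hLpos.le, inv_mul_le_iff₀ hLpos, mul_one]
    exact hx
  have downS : ∀ x ∈ sphere (0 : ι → ℝ) L, (L : ℝ)⁻¹ • x ∈ sphere (0 : ι → ℝ) 1 := by
    intro x hx
    rw [mem_sphere_iff_norm, sub_zero] at hx ⊢
    rw [norm_smul, norm_inv, Real.norm_of_nonneg hLpos.le, hx, inv_mul_cancel₀ hLpos.ne']
  set R : Set (ι → ℝ) → Finset (Fin n) := fun C =>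
    {j | ∀ x ∈ C, ‖f ((L : ℝ)⁻¹ • x) (b j)‖ < 1} with hR
  have memR : ∀ C j, j ∈ R C ↔ ∀ x ∈ C, ‖f ((L : ℝ)⁻¹ • x) (b j)‖ < 1 := fun C j => by simp [hR]
  set Z : Set (ι → ℝ) → Set K := fun C => Y \ ⋃ j ∈ R C, S j with hZ
  have ZY : ∀ C, Z C ⊆ Y := fun C => sdiff_subset
  have Zm : Monotone Z := fun C C' h => by
    refine sdiff_subset_sdiff_right (biUnion_subset_biUnion_left fun j hj => ?_)
    exact (memR C j).2 fun x hx => (memR C' j).1 hj x (h hx)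
  have Y₀Z : ∀ C, Y₀ ⊆ Z C ∩ {y | 1 ≤ (2 * n + 2) * N y} := by
    intro C y hy
    have hN := hc.norm_base y hy
    refine ⟨⟨Y₀Y hy, ?_⟩, ?_⟩
    · simp only [mem_iUnion, not_exists]
      rintro j - ⟨-, h⟩
      rw [hN] at h
      have : ((j : ℕ) : ℝ) + 1 ≤ n := by exact_mod_cast j.2
      linarith
    · rw [mem_ofPred_eq, hN]
      have : (0 : ℝ) ≤ n := Nat.cast_nonneg n
      linarith
  set W : Set (ι → ℝ) → Set (A →⋆ₙₐ[ℂ] G) := fun C =>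
    if C ⊆ sphere 0 L then supportedOn ρ π G Y₀ else supportedOn ρ π G (Z C) with hW
  set T : Set (ι → ℝ) → Set (A →⋆ₙₐ[ℂ] G) := fun C =>
    if C ⊆ sphere 0 L then supportedOn ρ π G Y₀
    else supportedOn ρ π G (Z C ∩ {y | 1 ≤ (2 * n + 2) * N y}) with hT
  have Wm : Monotone W := fun C C' h => by
    simp only [hW]
    by_cases h' : C' ⊆ sphere 0 (L : ℝ)
    · rw [if_pos h', if_pos (h.trans h')]
    · rw [if_neg h']
      split_ifs
      · exact supportedOn_mono ((Y₀Z C').trans inter_subset_left)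
      · exact supportedOn_mono (Zm h)
  have Tm : Monotone T := fun C C' h => by
    simp only [hT]
    by_cases h' : C' ⊆ sphere 0 (L : ℝ)
    · rw [if_pos h', if_pos (h.trans h')]
    · rw [if_neg h']
      split_ifs
      · exact supportedOn_mono (Y₀Z C')
      · exact supportedOn_mono (inter_subset_inter_left _ (Zm h))
  have fill : ∀ (a : ι → ℤ) (s : Finset ι), gridCell a s ⊆ closedBall 0 (L : ℝ) →
      Fillable s (W (gridCell a s)) (T (gridCell a s)) := by
    intro a s has
    simp only [hW, hT]
    split_ifs
    · exact (Compressible.refl _).fillable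
    · obtain ⟨j, hj⟩ := hLc a s has
      refine (compressible_diff_shells hA ih hc hP ⟨j, (memR _ j).2 hj⟩ s ?_).fillable
      rw [Fintype.card_coe]
      exact s.card_le_univ.trans_lt hι
  have start : ∀ (a : ι → ℤ) (s : Finset ι), gridCell a s ⊆ closedBall 0 (L : ℝ) →
      MapsTo (fun x => f ((L : ℝ)⁻¹ • x)) (gridCell a s) (W (gridCell a s)) := by
    intro a s has x hx
    simp only [hW]
    split_ifs with h
    · exact hfS (downS x (h hx))
    · exact mem_supportedOn_diff β1 β0 hb (hfY (down x (has hx)))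
        fun j hj => (memR _ j).1 hj x hx
  obtain ⟨H, Hc, H0, Hs⟩ := exists_homotopy_of_gridCell L Wm Tm fill
    (hf.comp (continuous_const_smul _).continuousOn down) start
  have up : ∀ x ∈ closedBall (0 : ι → ℝ) 1, (L : ℝ) • x ∈ closedBall (0 : ι → ℝ) L := by
    intro x hx
    rw [mem_closedBall, dist_zero_right] at hx ⊢
    rw [norm_smul, Real.norm_of_nonneg hLpos.le]
    nlinarith
  have upS : ∀ x ∈ sphere (0 : ι → ℝ) 1, (L : ℝ) • x ∈ sphere (0 : ι → ℝ) L := by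
    intro x hx
    rw [mem_sphere_iff_norm, sub_zero] at hx ⊢
    rw [norm_smul, Real.norm_of_nonneg hLpos.le, hx, mul_one]
  have W_le : ∀ C, W C ⊆ supportedOn ρ π G Y := fun C => by
    simp only [hW]
    split_ifs
    · exact supportedOn_mono Y₀Y
    · exact supportedOn_mono (ZY C)
  set ε : ℝ := 1 / (2 * n + 2) with hε
  have hε0 : 0 < ε := by positivity
  have hε1 : ε ≤ 1 := by
    rw [hε, div_le_one hn0]
    have : (0 : ℝ) ≤ n := Nat.cast_nonneg n
    linarith
  have T_le : ∀ C, T C ⊆ supportedOn ρ π G (Y₀ ∪ e '' {v | ε ≤ ‖v‖ ∧ ‖v‖ ≤ 1}) := fun C => by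
    simp only [hT]
    split_ifs
    · exact supportedOn_mono subset_union_left
    · refine supportedOn_mono ?_
      rintro y ⟨hy, hy1⟩
      have hyY := ZY C hy
      rw [hc.eq_union] at hyY
      rcases hyY with h | ⟨v, hv, rfl⟩
      · exact .inl h
      · rw [mem_ofPred_eq, hc.norm_map v hv] at hy1
        refine .inr ⟨v, ⟨?_, by simpa using hv⟩, rfl⟩
        rw [hε, div_le_iff₀ hn0]
        linarith
  have hfg : PairHomotopic (supportedOn ρ π G Y) (supportedOn ρ π G Y₀) f
      fun x => H (1, (L : ℝ) • x) := by
    refine ⟨fun p => H (p.1, (L : ℝ) • p.2), Hc.comp (by fun_prop) fun p hp => ⟨hp.1, up _ hp.2⟩,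
      fun x hx => ?_, fun _ _ => rfl, ?_, ?_⟩
    · dsimp only
      rw [H0 _ (up x hx)]
      rw [Function.comp_apply, smul_smul, inv_mul_cancel₀ hLpos.ne', one_smul]
    · rintro ⟨t, x⟩ ⟨ht, hx⟩
      exact W_le _ ((Hs _ _ (gridCell_floor_subset_closedBall (up x hx))).1
        ⟨ht, mem_gridCell_floor ((L : ℝ) • x)⟩)
    · rintro ⟨t, x⟩ ⟨ht, hx⟩
      have h1 := upS x hx
      have := @(Hs _ _ (gridCell_floor_subset_closedBall (sphere_subset_closedBall h1))).1
        (t, (L : ℝ) • x) ⟨ht, mem_gridCell_floor ((L : ℝ) • x)⟩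
      simpa only [hW, gridCell_floor_subset_sphere hL h1, if_true] using this
  have hgT : ∀ x ∈ closedBall (0 : ι → ℝ) 1,
      H (1, (L : ℝ) • x) ∈ supportedOn ρ π G (Y₀ ∪ e '' {v | ε ≤ ‖v‖ ∧ ‖v‖ ≤ 1}) := fun x hx =>
    T_le _ ((Hs _ _ (gridCell_floor_subset_closedBall (up x hx))).2 _ (mem_gridCell_floor _))
  -- once the support is off the centre of the cell it can be stretched to the boundary
  have hY := hc.eq_union
  subst hY
  have hempty : Y₀ ∪ e '' (∅ : Set (Fin (d + 1) → ℝ)) = Y₀ := by rw [image_empty, union_empty]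
  obtain ⟨g, hg, hgs⟩ := exists_pairHomotopic_push hA hc.isClosed hP hc.continuous_map
    hc.continuous_coord hc.coord_map (s := stretch ε) (continuous_stretch hε0)
    (fun t ht v hv => by
      rw [mem_closedBall, dist_zero_right] at hv ⊢; exact norm_stretch_le hε0 ht hv)
    (fun t ht v hv h => stretch_of_norm_eq_one hε1 t (by
      rw [← hc.norm_map v hv, hc.norm_base _ h])) (fun v _ => stretch_zero v)
    (B := ∅) (empty_subset _) (fun t ht v hv => hv.elim)
    hfg.continuousOn_right hfg.mapsTo_right (by
      rw [hempty]
      obtain ⟨H', -, -, h1', -, hT'⟩ := hfg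
      intro x hx
      rw [← h1' x (sphere_subset_closedBall hx)]
      exact hT' ⟨⟨zero_le_one, le_rfl⟩, hx⟩)
  rw [hempty] at hg
  refine ⟨g, hfg.trans hg, fun x hx => ?_⟩
  have h3 := hgs {v | ε ≤ ‖v‖ ∧ ‖v‖ ≤ 1} (sphere 0 1) (fun v hv => by simpa using hv.2)
    (fun v hv => by rw [mem_sphere_iff_norm, sub_zero]; exact norm_stretch_one hε0 hv.1) x hx
    (hgT x hx)
  refine supportedOn_mono (union_subset subset_rfl ?_) h3
  rintro _ ⟨v, hv, rfl⟩
  exact hc.map_sphere v hv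

/-- Attaching a `d`-cell does not change the space of *-homomorphisms into a finite dimensional
C*-algebra in dimensions below `d`, up to homotopy. -/
theorem cellsCompressible (hA : IsRelativeTo ρ π P) (d : ℕ) : CellsCompressible G ρ π P d := by
  induction d with
  | zero => exact fun _ _ _ _ _ _ _ _ _ h => absurd h (Nat.not_lt_zero _)
  | succ d ih => exact ih.succ hA

end Core

/-! ### Skeletons of NCCW complexes -/

section Complex

variable {n : ℕ} (A : NCCWComplex.{u} n)

theorem proj_last_apply (a : A.top) : A.proj (Fin.last n) a = a := by
  simp [NCCWComplex.proj]

theorem proj_castSucc_apply (k : Fin n) (a : A.top) :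
    A.proj k.castSucc a = A.toPrev k (A.proj k.succ a) := by
  simp [NCCWComplex.proj]

theorem eq_of_toCube_eq_of_toPrev_eq {k : Fin n} {x y : A.algebra k.succ}
    (h₁ : A.toCube k x = A.toCube k y) (h₂ : A.toPrev k x = A.toPrev k y) : x = y :=
  (A.pullback k (A.toCube k y) (A.toPrev k y) (A.comm k y)).unique ⟨h₁, h₂⟩ ⟨rfl, rfl⟩

theorem isClosed_boundary (ι : Type*) [Finite ι] : IsClosed (Cube.boundary ι) := by
  have : Cube.boundary ι = ⋃ i, ({y : ι → I | y i = 0} ∪ {y : ι → I | y i = 1}) := by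
    ext y; simp [Cube.boundary]
  rw [this]
  exact isClosed_iUnion_of_finite fun i =>
    (isClosed_eq (continuous_apply i) continuous_const).union
      (isClosed_eq (continuous_apply i) continuous_const)

theorem toPrev_surjective (k : Fin n) : Function.Surjective (A.toPrev k) := by
  intro a
  have := A.finiteDimensional_coeff k
  have : TietzeExtension (A.coeff k) := TietzeExtension.of_tvs ℂ
  obtain ⟨g, hg⟩ := ContinuousMap.exists_restrict_eq (isClosed_boundary _) (A.attach k a)
  obtain ⟨x, ⟨-, hx⟩, -⟩ := A.pullback k g a hg
  exact ⟨x, hx⟩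

theorem proj_surjective (k : Fin (n + 1)) : Function.Surjective (A.proj k) := by
  induction k using Fin.reverseInduction with
  | last => exact fun a => ⟨a, proj_last_apply A a⟩
  | cast k ih =>
    intro a
    obtain ⟨b, rfl⟩ := toPrev_surjective A k a
    obtain ⟨c, rfl⟩ := ih b
    exact ⟨c, proj_castSucc_apply A k c⟩

theorem proj_eq_zero_of_le {i j : Fin (n + 1)} (hij : i ≤ j) {a : A.top} (h : A.proj j a = 0) :
    A.proj i a = 0 := by
  induction i using Fin.reverseInduction with
  | last => rwa [Fin.last_le_iff.1 hij] at h
  | cast k ih =>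
    rcases hij.eq_or_lt with rfl | hlt
    · exact h
    · rw [proj_castSucc_apply, ih (Fin.castSucc_lt_iff_succ_le.1 hlt), map_zero]

theorem toSkeleton_eq_zero_of_le {i j : ℕ} (hij : i ≤ j) {a : A.top} (h : A.toSkeleton j a = 0) :
    A.toSkeleton i a = 0 :=
  proj_eq_zero_of_le A (by simp only [Fin.mk_le_mk]; omega) h

/-- The affine coordinates on the cube `[0, 1]^ι` with values in `[-1, 1]^ι`. -/
def cubeCoord {ι : Type*} (x : ι → I) (i : ι) : ℝ := 2 * (x i : ℝ) - 1

/-- The parametrization of the cube `[0, 1]^ι` by `[-1, 1]^ι`. -/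
noncomputable def cubeMap {ι : Type*} (y : ι → ℝ) (i : ι) : I :=
  projIcc 0 1 zero_le_one ((y i + 1) / 2)

theorem continuous_cubeCoord {ι : Type*} : Continuous (cubeCoord : (ι → I) → ι → ℝ) := by
  unfold cubeCoord; fun_prop

theorem continuous_cubeMap {ι : Type*} : Continuous (cubeMap : (ι → ℝ) → ι → I) :=
  continuous_pi fun _ => continuous_projIcc.comp (by fun_prop)

theorem cubeMap_cubeCoord {ι : Type*} (x : ι → I) : cubeMap (cubeCoord x) = x := by
  funext i
  have : (cubeCoord x i + 1) / 2 = x i := by unfold cubeCoord; ring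
  rw [cubeMap, this, projIcc_val]

variable {ι : Type*} [Fintype ι]

theorem cubeCoord_cubeMap {y : ι → ℝ} (hy : y ∈ closedBall 0 1) : cubeCoord (cubeMap y) = y := by
  rw [mem_closedBall, dist_zero_right, pi_norm_le_iff_of_nonneg zero_le_one] at hy
  funext i
  have h := abs_le.1 (Real.norm_eq_abs _ ▸ hy i)
  rw [cubeCoord, cubeMap, projIcc_of_mem zero_le_one
    (⟨by linarith, by linarith⟩ : (y i + 1) / 2 ∈ Icc (0 : ℝ) 1)]
  dsimp only
  ring

theorem cubeCoord_mem (x : ι → I) : cubeCoord x ∈ closedBall 0 1 := by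
  rw [mem_closedBall, dist_zero_right, pi_norm_le_iff_of_nonneg zero_le_one]
  intro i
  rw [Real.norm_eq_abs, abs_le, cubeCoord]
  constructor <;> linarith [(x i).2.1, (x i).2.2]

theorem cubeCoord_mem_sphere_iff {x : ι → I} :
    cubeCoord x ∈ sphere 0 1 ↔ x ∈ Cube.boundary ι := by
  have hle : ‖cubeCoord x‖ ≤ 1 := by simpa using cubeCoord_mem x
  rw [mem_sphere_iff_norm, sub_zero]
  constructor
  · intro h
    obtain ⟨i, hi⟩ := exists_norm_apply_eq zero_lt_one h
    refine ⟨i, ?_⟩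
    rw [Real.norm_eq_abs, cubeCoord] at hi
    rcases eq_or_eq_neg_of_abs_eq hi with h | h
    · exact .inr (Subtype.ext (by rw [Set.Icc.coe_one]; linarith))
    · exact .inl (Subtype.ext (by rw [Set.Icc.coe_zero]; linarith))
  · rintro ⟨i, hi⟩
    refine le_antisymm hle ?_
    have h1 : ‖cubeCoord x i‖ = 1 := by
      rw [cubeCoord]
      rcases hi with h | h <;> rw [h] <;> norm_num
    exact h1 ▸ norm_le_pi_norm _ i

theorem cubeMap_mem_boundary {y : ι → ℝ} (hy : y ∈ sphere 0 1) : cubeMap y ∈ Cube.boundary ι := by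
  rw [← cubeCoord_mem_sphere_iff, cubeCoord_cubeMap (sphere_subset_closedBall hy)]
  exact hy

/-- A cube is a cell attached to its boundary. -/
theorem isCell_cube (d : ℕ) : IsCell (Cube.boundary (Fin d)) univ cubeMap cubeCoord
    fun x => ‖cubeCoord x‖ where
  isClosed := isClosed_boundary _
  continuous_map := continuous_cubeMap
  continuous_coord := continuous_cubeCoord
  continuous_norm := continuous_cubeCoord.norm
  coord_map _ hv := cubeCoord_cubeMap hv
  norm_map v hv := by rw [cubeCoord_cubeMap hv]
  norm_base y hy := by simpa using cubeCoord_mem_sphere_iff.2 hy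
  eq_union := by
    refine (eq_univ_of_forall fun x => ?_).symm
    exact .inr ⟨cubeCoord x, cubeCoord_mem x, cubeMap_cubeCoord x⟩
  map_sphere _ hv := cubeMap_mem_boundary hv

/-- The *-homomorphisms `A → G` which factor through the quotient `A_k` of `A`. -/
def factoringThrough (G : Type*) [NonUnitalCStarAlgebra G] (k : Fin (n + 1)) :
    Set (A.top →⋆ₙₐ[ℂ] G) :=
  {φ | ∀ a, A.proj k a = 0 → φ a = 0}

theorem factoringThrough_mono (G : Type*) [NonUnitalCStarAlgebra G] {i j : Fin (n + 1)}
    (hij : i ≤ j) : factoringThrough A G i ⊆ factoringThrough A G j :=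
  fun _ hφ a ha => hφ a (proj_eq_zero_of_le A hij ha)

/-- The pullback property, seen from the top of the complex. -/
theorem isRelativeTo_boundary (k : Fin n) : IsRelativeTo ((A.toCube k).comp (A.proj k.succ))
    (A.proj k.castSucc) (Cube.boundary (Fin ((k : ℕ) + 1))) := by
  intro a g hg
  have h1 : g.restrict (Cube.boundary (Fin ((k : ℕ) + 1))) =
      A.attach k (A.proj k.castSucc a) := by
    rw [proj_castSucc_apply, ← A.comm k]
    ext y
    exact hg y y.2
  obtain ⟨x, ⟨hx, hx'⟩, -⟩ := A.pullback k g _ h1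
  obtain ⟨a', rfl⟩ := proj_surjective A k.succ x
  exact ⟨a', hx, by rw [proj_castSucc_apply, hx']⟩

/-- For *-homomorphisms on `A`, to be supported off the interior of the cube of `A_{k+1}` is to
factor through `A_k`. -/
theorem compressible_factoringThrough_castSucc (G : Type*) [NonUnitalCStarAlgebra G]
    [FiniteDimensional ℂ G] (k : Fin n) (ι : Type) [Fintype ι] (hι : Fintype.card ι ≤ k) :
    Compressible ι (factoringThrough A G k.succ) (factoringThrough A G k.castSucc) := by
  have := A.finiteDimensional_coeff k
  have key := cellsCompressible (G := G) (isRelativeTo_boundary A k) _ _ _ _ _ _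
    (isCell_cube ((k : ℕ) + 1)) subset_rfl ι (by omega)
  have e1 : supportedOn ((A.toCube k).comp (A.proj k.succ)) (A.proj k.castSucc) G univ =
      factoringThrough A G k.succ := by
    ext φ
    constructor
    · intro h a ha
      refine h a (by rw [proj_castSucc_apply, ha, map_zero]) fun y _ => ?_
      rw [NonUnitalStarAlgHom.comp_apply, ha, map_zero]
      rfl
    · intro h a ha hy
      refine h a (eq_of_toCube_eq_of_toPrev_eq A ?_ ?_)
      · ext y
        rw [map_zero]
        exact hy y (mem_univ y)
      · rw [map_zero, ← proj_castSucc_apply, ha]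
  have e2 : supportedOn ((A.toCube k).comp (A.proj k.succ)) (A.proj k.castSucc) G
      (Cube.boundary (Fin ((k : ℕ) + 1))) = factoringThrough A G k.castSucc := by
    ext φ
    constructor
    · intro h a ha
      refine h a ha fun y hy => ?_
      have h1 := DFunLike.congr_fun (A.comm k (A.proj k.succ a)) ⟨y, hy⟩
      rw [← proj_castSucc_apply, ha, map_zero] at h1
      exact h1
    · exact fun h a ha _ => h a ha
  rwa [e1, e2] at key

/-- Families of *-homomorphisms `A → G` over a cube of dimension at most `k` can be compressed to
families which factor through `A_k`. -/
theorem compressible_factoringThrough (G : Type*) [NonUnitalCStarAlgebra G]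
    [FiniteDimensional ℂ G] (k : Fin (n + 1)) (ι : Type) [Fintype ι] (hι : Fintype.card ι ≤ k) :
    Compressible ι univ (factoringThrough A G k) := by
  induction k using Fin.reverseInduction with
  | last =>
    have : factoringThrough A G (Fin.last n) = univ :=
      eq_univ_of_forall fun φ a ha => by rw [← proj_last_apply A a, ha, map_zero]
    rw [this]
    exact Compressible.refl _
  | cast k ih =>
    have hk : Fintype.card ι ≤ (k : ℕ) := hι
    exact (ih (by rw [Fin.val_succ]; omega)).trans (subset_univ _)
      (factoringThrough_mono A G (Fin.castSucc_lt_succ).le)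
      (compressible_factoringThrough_castSucc A G k ι hk)

theorem compressible_toSkeleton (G : Type*) [NonUnitalCStarAlgebra G]
    [FiniteDimensional ℂ G] (k : ℕ) (ι : Type) [Fintype ι] (hι : Fintype.card ι ≤ k) :
    Compressible ι univ {φ : A.top →⋆ₙₐ[ℂ] G | ∀ a, A.toSkeleton k a = 0 → φ a = 0} := by
  rcases le_total k n with h | h
  · exact compressible_factoringThrough A G ⟨min k n, by omega⟩ ι (by simpa [h] using hι)
  · have : {φ : A.top →⋆ₙₐ[ℂ] G | ∀ a, A.toSkeleton k a = 0 → φ a = 0} = univ := by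
      refine eq_univ_of_forall fun φ a ha => ?_
      have h1 : A.proj (Fin.last n) a = 0 :=
        proj_eq_zero_of_le A (by simp only [Fin.le_def, Fin.val_last]; omega) ha
      rw [← proj_last_apply A a, h1, map_zero]
    rw [this]
    exact Compressible.refl _

end Complex

/-! ### Deformation to a cellular map -/

section Main

open scoped CStarAlgebra

variable {n m : ℕ} (A : NCCWComplex.{u} n) (B : NCCWComplex.{v} m)

/-- A path of *-homomorphisms into a pullback is a pair of compatible paths. -/
theorem exists_path_of_toCube_toPrev (k : Fin m)
    {H : ℝ × (Fin ((k : ℕ) + 1) → ℝ) → A.top →⋆ₙₐ[ℂ] B.coeff k}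
    (hH : ContinuousOn H (Icc 0 1 ×ˢ closedBall 0 1))
    {γ : ℝ → A.top →⋆ₙₐ[ℂ] B.algebra k.castSucc} (hγ : ContinuousOn γ (Icc 0 1))
    (hHγ : ∀ t ∈ Icc (0 : ℝ) 1, ∀ a, ∀ x : Cube.boundary (Fin ((k : ℕ) + 1)),
      H (t, cubeCoord x.1) a = B.attach k (γ t a) x) :
    ∃ γ' : ℝ → A.top →⋆ₙₐ[ℂ] B.algebra k.succ, ContinuousOn γ' (Icc 0 1) ∧
      ∀ t ∈ Icc (0 : ℝ) 1, ∀ a,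
        (∀ x, B.toCube k (γ' t a) x = H (t, cubeCoord x) a) ∧ B.toPrev k (γ' t a) = γ t a := by
  have slice : ∀ t ∈ Icc (0 : ℝ) 1, ∀ a, ∃ b : B.algebra k.succ,
      (∀ x, B.toCube k b x = H (t, cubeCoord x) a) ∧ B.toPrev k b = γ t a := by
    intro t ht a
    have hc : Continuous fun x : Fin ((k : ℕ) + 1) → I => H (t, cubeCoord x) a := by
      rw [← continuousOn_univ]
      exact (continuousOn_hom_iff.1 hH a).comp
        (continuous_const.prodMk continuous_cubeCoord).continuousOn
        fun x _ => ⟨ht, cubeCoord_mem x⟩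
    obtain ⟨b, ⟨h1, h2⟩, -⟩ := B.pullback k ⟨_, hc⟩ (γ t a) (by
      ext x
      exact hHγ t ht a x)
    exact ⟨b, fun x => by rw [h1]; rfl, h2⟩
  have hom : ∀ t, ∃ ψ : A.top →⋆ₙₐ[ℂ] B.algebra k.succ, t ∈ Icc (0 : ℝ) 1 → ∀ a,
      (∀ x, B.toCube k (ψ a) x = H (t, cubeCoord x) a) ∧ B.toPrev k (ψ a) = γ t a := by
    intro t
    by_cases ht : t ∈ Icc (0 : ℝ) 1
    swap
    · exact ⟨0, fun h => absurd h ht⟩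
    choose ψ hψ hψ' using slice t ht
    have uniq : ∀ a b, (∀ x, B.toCube k b x = H (t, cubeCoord x) a) → B.toPrev k b = γ t a →
        ψ a = b := fun a b h1 h2 =>
      eq_of_toCube_eq_of_toPrev_eq B (by ext x; rw [hψ, h1]) (by rw [hψ', h2])
    exact ⟨{ toFun := ψ
             map_smul' := fun c x => uniq _ _ (fun y => by simp [hψ]) (by simp [hψ'])
             map_zero' := uniq _ _ (fun y => by simp) (by simp)
             map_add' := fun x x' => uniq _ _ (fun y => by simp [hψ]) (by simp [hψ'])
             map_mul' := fun x x' => uniq _ _ (fun y => by simp [hψ]) (by simp [hψ'])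
             map_star' := fun x => uniq _ _ (fun y => by
               rw [map_star, map_star, ← hψ]; rfl) (by rw [map_star, map_star, hψ']) },
      fun _ a => ⟨hψ a, hψ' a⟩⟩
  choose γ' hγ' using hom
  refine ⟨γ', ?_, hγ'⟩
  rw [continuousOn_hom_iff]
  intro a
  -- the two projections of the pullback form an injective, hence isometric, *-homomorphism
  set j := (B.toCube k).prod (B.toPrev k) with hj
  have hinj : Function.Injective j := fun x y hxy =>
    eq_of_toCube_eq_of_toPrev_eq B (congrArg Prod.fst hxy) (congrArg Prod.snd hxy)
  rw [(NonUnitalStarAlgHom.isometry j hinj).isEmbedding.isInducing.continuousOn_iff]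
  refine ContinuousOn.prodMk ?_ ?_
  · rw [continuousOn_iff_continuous_domRestrict]
    refine ContinuousMap.continuous_of_continuous_uncurry _ ?_
    have h1 := continuousOn_hom_iff.1 hH a
    have h2 : Continuous fun p : Icc (0 : ℝ) 1 × (Fin ((k : ℕ) + 1) → I) =>
        H ((p.1 : ℝ), cubeCoord p.2) a := by
      rw [← continuousOn_univ]
      refine h1.comp (Continuous.continuousOn ?_) fun p _ => ⟨p.1.2, cubeCoord_mem p.2⟩
      exact (continuous_subtype_val.comp continuous_fst).prodMk
        (continuous_cubeCoord.comp continuous_snd)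
    refine h2.congr fun p => ?_
    exact ((hγ' p.1 p.1.2 a).1 p.2).symm
  · exact (continuousOn_hom_iff.1 hγ a).congr fun t ht => (hγ' t ht a).2

/-- Extension of a deformation over one skeleton of `B` to the next: the given path prescribes a
homotopy on the boundary of the cube, and `f` its start on all of the cube. -/
theorem exists_path_succ (f : A.top →⋆ₙₐ[ℂ] B.top) (k : Fin m)
    {γ : ℝ → A.top →⋆ₙₐ[ℂ] B.algebra k.castSucc} (hγ : ContinuousOn γ (Icc 0 1))
    (hγ0 : ∀ a, γ 0 a = B.proj k.castSucc (f a))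
    (hγ1 : ∀ a, A.toSkeleton k a = 0 → γ 1 a = 0) :
    ∃ γ' : ℝ → A.top →⋆ₙₐ[ℂ] B.algebra k.succ, ContinuousOn γ' (Icc 0 1) ∧
      (∀ a, γ' 0 a = B.proj k.succ (f a)) ∧ (∀ a, B.toPrev k (γ' 1 a) = γ 1 a) ∧
      ∀ a, A.toSkeleton (k + 1) a = 0 → γ' 1 a = 0 := by
  classical
  have h0 : (0 : ℝ) ∈ Icc (0 : ℝ) 1 := ⟨le_rfl, zero_le_one⟩
  have h1 : (1 : ℝ) ∈ Icc (0 : ℝ) 1 := ⟨zero_le_one, le_rfl⟩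
  have := B.finiteDimensional_coeff k
  have : CompactSpace (Cube.boundary (Fin ((k : ℕ) + 1))) :=
    isCompact_iff_compactSpace.1 (isClosed_boundary _).isCompact
  set φ₀ : (Fin ((k : ℕ) + 1) → ℝ) → A.top →⋆ₙₐ[ℂ] B.coeff k := fun y =>
    (evalHom (B.coeff k) (cubeMap y)).comp ((B.toCube k).comp ((B.proj k.succ).comp f)) with hφ₀
  -- off the boundary only the values at time `0` matter
  set h : ℝ × (Fin ((k : ℕ) + 1) → ℝ) → A.top →⋆ₙₐ[ℂ] B.coeff k := fun p =>
    if hy : cubeMap p.2 ∈ Cube.boundary (Fin ((k : ℕ) + 1)) then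
      (evalHom (B.coeff k) (⟨cubeMap p.2, hy⟩ : Cube.boundary (Fin ((k : ℕ) + 1)))).comp
        ((B.attach k).comp (γ p.1))
    else φ₀ p.2 with hh
  have h_bdry : ∀ t y, ∀ hy : cubeMap y ∈ Cube.boundary (Fin ((k : ℕ) + 1)), ∀ a,
      h (t, y) a = B.attach k (γ t a) ⟨cubeMap y, hy⟩ := by
    intro t y hy a
    simp only [hh, hy, dif_pos]
    rfl
  have h_zero : ∀ y, h (0, y) = φ₀ y := by
    intro y
    by_cases hy : cubeMap y ∈ Cube.boundary (Fin ((k : ℕ) + 1))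
    · ext a
      rw [h_bdry 0 y hy, hγ0, proj_castSucc_apply, ← B.comm]
      rfl
    · simp only [hh, hy, dif_neg, not_false_eq_true]
  have hcont : ContinuousOn h ({0} ×ˢ closedBall 0 1 ∪ Icc 0 1 ×ˢ sphere 0 1) := by
    refine ContinuousOn.union_of_isClosed ?_ ?_ (isClosed_singleton.prod isClosed_closedBall)
      (isClosed_Icc.prod isClosed_sphere)
    · rw [continuousOn_hom_iff]
      intro a
      have : Continuous fun p : ℝ × (Fin ((k : ℕ) + 1) → ℝ) =>
          B.toCube k (B.proj k.succ (f a)) (cubeMap p.2) :=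
        (map_continuous _).comp (continuous_cubeMap.comp continuous_snd)
      refine this.continuousOn.congr ?_
      rintro ⟨t, y⟩ ⟨ht, -⟩
      obtain rfl : t = 0 := ht
      dsimp only
      rw [h_zero]
      rfl
    · rw [continuousOn_hom_iff]
      intro a
      rw [continuousOn_iff_continuous_domRestrict]
      set Z : Set (ℝ × (Fin ((k : ℕ) + 1) → ℝ)) := Icc 0 1 ×ˢ sphere 0 1
      have hg : Continuous fun z : Z => B.attach k (γ z.1.1 a) := by
        refine (map_continuous (B.attach k)).comp ?_
        rw [← continuousOn_univ]
        exact (continuousOn_hom_iff.1 hγ a).comp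
          (continuous_fst.comp continuous_subtype_val).continuousOn fun z _ => z.2.1
      have he : Continuous fun z : Z =>
          (⟨cubeMap z.1.2, cubeMap_mem_boundary z.2.2⟩ : Cube.boundary (Fin ((k : ℕ) + 1))) :=
        (continuous_cubeMap.comp (continuous_snd.comp continuous_subtype_val)).subtype_mk _
      refine (hg.eval he).congr fun z => ?_
      exact (h_bdry z.1.1 z.1.2 (cubeMap_mem_boundary z.2.2) a).symm
  have hend : ∀ y ∈ sphere (0 : Fin ((k : ℕ) + 1) → ℝ) 1,
      h (1, y) ∈ {φ : A.top →⋆ₙₐ[ℂ] B.coeff k | ∀ a, A.toSkeleton (k + 1) a = 0 → φ a = 0} := by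
    intro y hy a ha
    rw [h_bdry 1 y (cubeMap_mem_boundary hy),
      hγ1 a (toSkeleton_eq_zero_of_le A (Nat.le_succ _) ha), map_zero]
    rfl
  obtain ⟨H, hH, hHh, -, hH1⟩ := (compressible_toSkeleton A (B.coeff k) (k + 1)
    (Fin ((k : ℕ) + 1)) (by simp)).fillable h hcont (mapsTo_univ _ _) hend
  have hH0 : ∀ y ∈ closedBall (0 : Fin ((k : ℕ) + 1) → ℝ) 1, H (0, y) = φ₀ y := fun y hy =>
    (hHh (.inl (mk_mem_prod (mem_singleton 0) hy))).trans (h_zero y)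
  have hHb : ∀ t ∈ Icc (0 : ℝ) 1, ∀ y ∈ sphere (0 : Fin ((k : ℕ) + 1) → ℝ) 1,
      H (t, y) = h (t, y) := fun t ht y hy => hHh (.inr (mk_mem_prod ht hy))
  clear_value h φ₀
  obtain ⟨γ', hγ', hγ'H⟩ := exists_path_of_toCube_toPrev A B k hH hγ fun t ht a x => by
    have hx := cubeCoord_mem_sphere_iff.2 x.2
    have hx' : cubeMap (cubeCoord x.1) ∈ Cube.boundary (Fin ((k : ℕ) + 1)) := by
      rw [cubeMap_cubeCoord]; exact x.2
    rw [hHb t ht _ hx, h_bdry t _ hx']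
    exact congrArg _ (Subtype.ext (cubeMap_cubeCoord x.1))
  refine ⟨γ', hγ', fun a => ?_, fun a => (hγ'H 1 h1 a).2, fun a ha => ?_⟩
  · refine eq_of_toCube_eq_of_toPrev_eq B ?_ ?_
    · ext x
      rw [(hγ'H 0 h0 a).1, hH0 _ (cubeCoord_mem x), hφ₀]
      change B.toCube k (B.proj k.succ (f a)) (cubeMap (cubeCoord x)) = _
      rw [cubeMap_cubeCoord]
    · rw [(hγ'H 0 h0 a).2, hγ0, proj_castSucc_apply]
  · refine eq_of_toCube_eq_of_toPrev_eq B ?_ ?_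
    · ext x
      rw [(hγ'H 1 h1 a).1, map_zero, hH1 _ (cubeCoord_mem x) a ha]
      rfl
    · rw [(hγ'H 1 h1 a).2, map_zero, hγ1 a (toSkeleton_eq_zero_of_le A (Nat.le_succ _) ha)]

/-- A *-homomorphism `f : A → B` followed by the projection to `B_j` is the start of a path at
whose end the skeletons up to `j` are respected. -/
theorem exists_path_proj (f : A.top →⋆ₙₐ[ℂ] B.top) (j : Fin (m + 1)) :
    ∃ γ : ℝ → A.top →⋆ₙₐ[ℂ] B.algebra j, ContinuousOn γ (Icc 0 1) ∧
      (∀ a, γ 0 a = B.proj j (f a)) ∧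
      ∀ i ≤ j, ∀ a, A.toSkeleton i a = 0 → ∀ b, B.proj j b = γ 1 a → B.proj i b = 0 := by
  induction j using Fin.induction with
  | zero =>
    have := B.finiteDimensional_zero
    -- over the cube of dimension `0` there is only the starting point of the homotopy to prescribe
    have hs : sphere (0 : Fin 0 → ℝ) 1 = ∅ := sphere_eq_empty_of_subsingleton one_ne_zero
    obtain ⟨H, hH, hHf, -, hH1⟩ := (compressible_toSkeleton A (B.algebra 0) 0 (Fin 0)
      (by simp)).fillable (fun _ => (B.proj 0).comp f) continuousOn_const (mapsTo_univ _ _)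
      (fun y hy => absurd hy (by rw [hs]; exact notMem_empty y))
    refine ⟨fun t => H (t, 0), hH.comp (by fun_prop) fun t ht => ⟨ht, mem_closedBall_self zero_le_one⟩,
      fun a => ?_, ?_⟩
    · dsimp only
      rw [hHf (.inl (mk_mem_prod (mem_singleton 0) (mem_closedBall_self zero_le_one)))]
      rfl
    · intro i hi a ha b hb
      obtain rfl : i = 0 := Fin.le_zero_iff.1 hi
      rw [hb]
      exact hH1 0 (mem_closedBall_self zero_le_one) a ha
  | succ k ih =>
    obtain ⟨γ, hγ, hγ0, hγ1⟩ := ih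
    obtain ⟨γ', hγ', hγ'0, hprev, hγ'1⟩ := exists_path_succ A B f k hγ hγ0 fun a ha => by
      obtain ⟨b, hb⟩ := proj_surjective B k.castSucc (γ 1 a)
      rw [← hb]
      exact hγ1 _ le_rfl a ha b hb
    refine ⟨γ', hγ', hγ'0, fun i hi a ha b hb => ?_⟩
    rcases hi.eq_or_lt with rfl | hlt
    · rw [hb]
      exact hγ'1 a ha
    · exact hγ1 i (Fin.le_castSucc_iff.2 hlt) a ha b (by
        rw [proj_castSucc_apply, hb, hprev])

end Main

end CellularApprox

theorem mainTheorem1 {n m : ℕ} (A : NCCWComplex.{u} n) (B : NCCWComplex.{v} m)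
    (f : A.top →⋆ₙₐ[ℂ] B.top) :
    ∃ h : A.top →⋆ₙₐ[ℂ] B.top, CStarHomotopic f h ∧ NCCWComplex.IsCellular A B h := by
  obtain ⟨γ, hγ, hγ0, hγ1⟩ := CellularApprox.exists_path_proj A B f (Fin.last m)
  have hc : ∀ a, Continuous fun t : I => γ t a := fun a => by
    rw [← continuousOn_univ]
    exact (CellularApprox.continuousOn_hom_iff.1 hγ a).comp
      continuous_subtype_val.continuousOn fun t _ => t.2
  refine ⟨γ 1, ⟨{ toFun := fun a => ⟨fun t => γ t a, hc a⟩
                  map_smul' := fun c x => by ext; simp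
                  map_zero' := by ext; simp
                  map_add' := fun x y => by ext; simp
                  map_mul' := fun x y => by ext; simp
                  map_star' := fun x => by ext; simp [map_star] }, fun a => ?_, fun a => ?_⟩, ?_⟩
  · exact (hγ0 a).trans (CellularApprox.proj_last_apply B _)
  · rfl
  · intro k
    refine CellularApprox.exists_hom_of_ker_le (CellularApprox.proj_surjective A _)
      ((B.toSkeleton k).comp (γ 1)) fun a ha => ?_
    exact hγ1 ⟨min k m, by omega⟩ (Fin.le_last _) a
      (CellularApprox.toSkeleton_eq_zero_of_le A (min_le_left k m) ha) _
      (CellularApprox.proj_last_apply B _)
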